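/- **Setting.** Let $R$ be a reduced irreducible (crystallographic) root system with simple roots $\alpha_1,\dots,\alpha_n$, positive roots $R^+$ and highest root $\theta=\sum_i k_i\alpha_i$, acting as functionals on the $n$-dimensional real space $\mathfrak h$ that contains the coroots; let $\omega_1,\dots,\omega_n\in\mathfrak h$ be the fundamental coweights (the basis dual to the simple roots) and $P=\bigoplus_i\mathbb Z\omega_i$. For $\alpha\in R$, $k\in\mathbb Z$ put $s_{\alpha+k\delta}(x)=x-(\langle x,\alpha\rangle+k)\alpha^\vee$, the reflection in $H_{\alpha+k\delta}=\{x:\langle x,\alpha\rangle=-k\}$. Let $W$ be the affine Weyl group generated by all $s_{\alpha+k\delta}$, with Coxeter generators $s_0=s_{-\theta+\delta}$ and $s_i=s_{\alpha_i}$ $(1\le i\le n)$, and identify $w\in W$ with the alcove $w\mathfrak a$, where $\mathfrak a=\{x:\langle x,\alpha_i\rangle>0\ (1\le i\le n),\ \langle x,\theta\rangle<1\}$. For $\alpha\in R^+$ the positive side of $H_{\alpha+k\delta}$ is $\{\langle x,\alpha\rangle\ge -k\}$ and the negative side is $\{\langle x,\alpha\rangle\le -k\}$. For adjacent alcoves $x,y$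 call $x\to y$ a *positive crossing* if the hyperplane separating them has $x$ on its negative side and $y$ on its positive side, and a *negative crossing* if it is the other way round. Let $\Sigma$ be the Coxeter complex, whose simplices are the nonempty sets of vertices of an alcove; the vertices $0$ and $\omega_i/k_i$ of $\mathfrak a$ have types $0$ and $i$, and $W$ preserves types. Sectors of $\Sigma$ are the images of the Weyl chambers under $P\rtimes W_0$, where $W_0$ is the finite Weyl group; $C_0=\{x:\langle x,\alpha_i\rangle>0\text{ for }1\le i\le n\}$, and $w_0$ is the longest element of $W_0$, so that $w_0C_0=-C_0$. A *building of type $W$* is a nonempty simplicial complex $X$, each of whose simplices lies in a maximal simplex (*chamber*), with a set of subcomplexes (*apartments*) such that: each apartment is isomorphic to $\Sigma$; any two chambers lie in a common apartment; and for apartments $A,A'$ with $A\cap A'\ne\emptyset$ there is an isomorphism $A'\to A$ fixing $A\cap A'$ pointwise. Assume that the apartment system is complete, that is, every subcomplex of $X$ isomorphic to $\Sigma$ is an apartment. Fix an apartment and an isomorphism of it with $\Sigma$, and so regard $\Sigma$ as an apartment of $X$ and its alcoves $w\in W$ as chambers of $X$. The type function of $\Sigma$ extends uniquely to the vertices of $X$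 so that every chamber has exactly one vertex of each type $0,\dots,n$; a panel (codimension-one simplex) has *cotype* $i$ if it has a vertex of every type except $i$, and two chambers are *$i$-adjacent* if they share a panel of cotype $i$. Assume that $X$ is *regular*: any two panels of the same cotype are contained in equally many chambers (as cardinal numbers, possibly infinite). The retraction $\rho_{-\infty}$ sends a chamber $c$ of $X$ to $\psi(c)$, where $\psi:A\to\Sigma$ is an isomorphism fixing $A\cap\Sigma$ pointwise and $A$ is any apartment that contains $c$ and a subsector of $w_0C_0$. For each $i\in\{0,\dots,n\}$ let $\mathbf q_i$ be a set with a distinguished element $0$ that indexes the chambers $i$-adjacent to, and different from, a given chamber (by regularity its cardinality does not depend on the chamber). **Proposition.** Let $\vec w=s_{i_1}\cdots s_{i_\ell}$ be a reduced expression and let $v\in W$. Let $\mathcal G(\vec w)_v$ be the set of galleries $c_0,\dots,c_\ell$ of type $\vec w$ in $X$ (chambers with $c_{k-1}\neq c_k$ and $c_{k-1}$, $c_k$ $i_k$-adjacent for $1\le k\le\ell$) with $c_0=1\in\Sigma$ and $\rho_{-\infty}(c_\ell)=v$. Then $\mathcal G(\vec w)_v$ is in bijection with the set of $\mathbf q$-labelled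 positively folded alcove walks of type $\vec w$ ending at $v$, that is, the sequences of alcoves $1=x_0,x_1,\dots,x_\ell=v$ in $W$ with labels $z_k\in\mathbf q_{i_k}$ $(1\le k\le\ell)$ such that, for each $k$, with $x=x_{k-1}$ and $s=s_{i_k}$, one of the following holds: - (positive crossing) $x_k=xs$, $x\to xs$ is a positive crossing, and $z_k\in\mathbf q_{i_k}$ is arbitrary; - (positive fold) $x_k=x$, $x\to xs$ is a negative crossing, and $z_k\in\mathbf q_{i_k}\setminus\{0\}$; - (negative crossing) $x_k=xs$, $x\to xs$ is a negative crossing, and $z_k=0$. Moreover, the bijection can be chosen so that a gallery $c_0,\dots,c_\ell$ corresponds to a walk with alcoves $x_k=\rho_{-\infty}(c_k)$, $0\le k\le\ell$. -/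

import Mathlib

noncomputable section

namespace AffineBuilding

/-! ### The affine Weyl group and its alcoves

Throughout, `P` is a root system with roots in `M` and coroots in `N`, and `b` is a base of `P`.
The space `N` (which contains the coroots and the coweights) carries the affine hyperplane
arrangement, and a root `α` is the linear functional `P.root' α` on `N`. -/

section Geometry

variable {ι M N : Type*} [AddCommGroup M] [Module ℝ M] [AddCommGroup N] [Module ℝ N]

/-- The reflection `s_{α + kδ}` in the hyperplane `⟨x, α⟩ = -k`. -/
def affineReflection (P : RootPairing ι ℝ M N) (α : ι) (k : ℤ) : N ≃ᵃ[ℝ] N :=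
  (P.coreflection α).toAffineEquiv.trans (AffineEquiv.constVAdd ℝ N (-(k : ℝ) • P.coroot α))

theorem affineReflection_apply (P : RootPairing ι ℝ M N) (α : ι) (k : ℤ) (x : N) :
    affineReflection P α k x = x - (P.root' α x + (k : ℝ)) • P.coroot α := by
  simp only [affineReflection, AffineEquiv.trans_apply, LinearEquiv.coe_toAffineEquiv,
    AffineEquiv.constVAdd_apply, vadd_eq_add, RootPairing.coreflection_apply]
  module

/-- The affine Weyl group: the group generated by all the reflections `s_{α + kδ}`. -/
def affineWeylGroup (P : RootPairing ι ℝ M N) : Subgroup (N ≃ᵃ[ℝ] N) :=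
  Subgroup.closure (Set.range fun p : ι × ℤ => affineReflection P p.1 p.2)

/-- The (finite) Weyl group, acting linearly on `N`. -/
def finiteWeylGroup (P : RootPairing ι ℝ M N) : Subgroup (N ≃ₗ[ℝ] N) :=
  Subgroup.closure (Set.range P.coreflection)

variable {P : RootPairing ι ℝ M N}

/-- The set `{0, …, n}` of types; `none` is the type `0`, and `some i` belongs to the simple
root `α_i`. -/
abbrev Node (b : P.Base) : Type _ := Option b.support

variable [P.IsRootSystem] (b : P.Base)

/-- `θ` is a highest root: every coefficient of `θ` in the simple roots is at least the
corresponding coefficient of any root. -/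
def IsHighestRoot (θ : ι) : Prop :=
  ∀ (i : b.support) (α : ι),
    b.toWeightBasis.repr (P.root α) i ≤ b.toWeightBasis.repr (P.root θ) i

/-- The fundamental coweights: the basis of `N` dual to the simple roots. -/
def fundamentalCoweight (i : b.support) : N :=
  P.flip.toLinearMap.toPerfPair.symm (b.toWeightBasis.coord i)

theorem root'_fundamentalCoweight (i j : b.support) :
    P.root' j (fundamentalCoweight b i) = Finsupp.single j (1 : ℝ) i := by
  have h : P.flip.toLinearMap.toPerfPair (fundamentalCoweight b i) = b.toWeightBasis.coord i := by
    simp [fundamentalCoweight]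
  have h2 := LinearMap.congr_fun h (P.root j)
  rw [LinearMap.toPerfPair_apply] at h2
  simp only [Module.Basis.coord_apply, RootPairing.Base.toWeightBasis_repr_root] at h2
  simpa using h2

/-- The coweight lattice. -/
def coweightLattice : AddSubgroup N :=
  AddSubgroup.closure (Set.range (fundamentalCoweight b))

/-- The fundamental Weyl chamber `C_0`. -/
def weylChamber : Set N := {x | ∀ i : b.support, 0 < P.root' i x}

/-- The Weyl chamber `w_0 C_0` opposite to `C_0` (it equals `-C_0`). -/
def oppositeWeylChamber : Set N := {x | ∀ i : b.support, P.root' i x < 0}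

/-- Sectors: the images of Weyl chambers under the extended affine Weyl group. -/
def IsSector (T : Set N) : Prop :=
  ∃ μ ∈ coweightLattice b, ∃ u ∈ finiteWeylGroup P, T = (fun x => u x + μ) '' weylChamber b

variable [Nonempty ι]

/-- The highest root. -/
def highestRoot : ι := Classical.epsilon (IsHighestRoot b)

/-- The Coxeter generators `s_0, s_1, …, s_n` of the affine Weyl group; `s_0` is the reflection in
the hyperplane `⟨x, θ⟩ = 1`, where `θ` is the highest root. -/
def simpleReflection : Node b → affineWeylGroup P
  | none => ⟨affineReflection P (highestRoot b) (-1), Subgroup.subset_closure ⟨(_, _), rfl⟩⟩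
  | some i => ⟨affineReflection P i 0, Subgroup.subset_closure ⟨(_, _), rfl⟩⟩

/-- The element of the affine Weyl group spelled by a word in the Coxeter generators. -/
def wordProd {l : ℕ} (word : Fin l → Node b) : affineWeylGroup P :=
  (List.ofFn fun k => simpleReflection b (word k)).prod

/-- A word is reduced if no shorter word spells the same element. -/
def IsReducedWord {l : ℕ} (word : Fin l → Node b) : Prop :=
  ∀ (l' : ℕ) (word' : Fin l' → Node b), wordProd b word' = wordProd b word → l ≤ l'

/-- The fundamental alcove: `⟨x, α_i⟩ > 0` for `i = 0, …, n`, where `α_0 = -θ + δ`. -/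
def fundamentalAlcove : Set N :=
  {x | (∀ i : b.support, 0 < P.root' i x) ∧ 0 < -P.root' (highestRoot b) x + 1}

/-- The alcove corresponding to an element of the affine Weyl group. -/
def alcove (w : affineWeylGroup P) : Set N := (w : N ≃ᵃ[ℝ] N) '' fundamentalAlcove b

/-- The step from the alcove `x` to the adjacent alcove `y` is a positive crossing: some
hyperplane `H_{α + kδ}`, `α` a positive root, has `x` on its negative and `y` on its positive
side. -/
def IsPositiveCrossing (x y : affineWeylGroup P) : Prop :=
  ∃ α : ι, b.IsPos α ∧ ∃ k : ℤ,
    (∀ a ∈ alcove b x, P.root' α a + (k : ℝ) ≤ 0) ∧ (∀ a ∈ alcove b y, 0 ≤ P.root' α a + (k : ℝ))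

/-- The vertices `0` (of type `0`) and `ω_i / k_i` (of type `i`) of the fundamental alcove, where
`k_i` is the coefficient of `α_i` in the highest root. -/
def fundamentalVertex : Node b → N
  | none => 0
  | some i => (b.toWeightBasis.repr (P.root (highestRoot b)) i)⁻¹ • fundamentalCoweight b i

open Classical in
/-- The set of vertices of the alcove corresponding to `w`. -/
def alcoveVertices (w : affineWeylGroup P) : Finset N :=
  Finset.univ.image fun i : Node b => (w : N ≃ᵃ[ℝ] N) (fundamentalVertex b i)

/-- The Coxeter complex `Σ`: its simplices are the nonempty sets of vertices of an alcove. -/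
def coxeterComplex : PreAbstractSimplicialComplex N where
  faces := {s | s.Nonempty ∧ ∃ w : affineWeylGroup P, s ⊆ alcoveVertices b w}
  isRelLowerSet_faces := fun _ h =>
    ⟨h.1, fun _ hts ht => ⟨ht, h.2.imp fun _ hw => Finset.Subset.trans hts hw⟩⟩

end Geometry

/-! ### Simplicial complexes -/

section Complexes

variable {V V' : Type*}

/-- The vertices of a simplicial complex. -/
def vertices (K : PreAbstractSimplicialComplex V) : Set V := {x | {x} ∈ K}

open Classical in
/-- `f` restricts to an isomorphism of simplicial complexes from `K` to `L` (its values outside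
the vertices of `K` are irrelevant). -/
def IsSimplicialIso (K : PreAbstractSimplicialComplex V) (L : PreAbstractSimplicialComplex V')
    (f : V → V') : Prop :=
  Set.BijOn f (vertices K) (vertices L) ∧
    ∀ s : Finset V, (s : Set V) ⊆ vertices K → (s ∈ K ↔ s.image f ∈ L)

/-- The chambers of a simplicial complex are its maximal simplices. -/
def IsChamber (K : PreAbstractSimplicialComplex V) (c : Finset V) : Prop :=
  Maximal (fun s => s ∈ K) c

/-- Panels: simplices of codimension one. -/
def IsPanel (K : PreAbstractSimplicialComplex V) (p : Finset V) : Prop :=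
  p ∈ K ∧ ∃ c, IsChamber K c ∧ p ⊆ c ∧ c.card = p.card + 1

end Complexes

/-! ### Affine buildings -/

variable {ι M N : Type*} [AddCommGroup M] [Module ℝ M] [AddCommGroup N] [Module ℝ N]
  {P : RootPairing ι ℝ M N} [P.IsRootSystem] [Nonempty ι]

/-- A building, with its apartments, whose type is the affine Weyl group of `P`. -/
structure Building (b : P.Base) (V : Type*) where
  /-- the underlying simplicial complex -/
  complex : PreAbstractSimplicialComplex V
  /-- the apartments -/
  apartments : Set (PreAbstractSimplicialComplex V)
  nonempty : ∃ s, s ∈ complex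
  exists_chamber : ∀ s ∈ complex, ∃ c, IsChamber complex c ∧ s ⊆ c
  apartment_le : ∀ A ∈ apartments, A ≤ complex
  /-- every apartment is isomorphic to the Coxeter complex -/
  apartment_iso : ∀ A ∈ apartments, ∃ f : N → V, IsSimplicialIso (coxeterComplex b) A f
  /-- any two chambers lie in a common apartment -/
  exists_apartment : ∀ c d, IsChamber complex c → IsChamber complex d →
    ∃ A ∈ apartments, c ∈ A ∧ d ∈ A
  /-- intersecting apartments are isomorphic by a map that fixes their intersection -/
  exists_iso : ∀ A ∈ apartments, ∀ A' ∈ apartments, (∃ s, s ∈ A ⊓ A') →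
    ∃ f : V → V, IsSimplicialIso A' A f ∧ ∀ x ∈ vertices (A ⊓ A'), f x = x

namespace Building

variable {b : P.Base} {V : Type*}

/-- The system of apartments is the complete one: every subcomplex isomorphic to the Coxeter
complex is an apartment. -/
def IsComplete (X : Building b V) : Prop :=
  ∀ A ≤ X.complex, (∃ f : N → V, IsSimplicialIso (coxeterComplex b) A f) → A ∈ X.apartments

/-- An apartment of `X` together with an identification of the Coxeter complex with it. -/
structure Marking (X : Building b V) where
  /-- the fixed apartment -/
  apartment : PreAbstractSimplicialComplex V
  mem_apartments : apartment ∈ X.apartments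
  /-- the isomorphism from the Coxeter complex to the fixed apartment -/
  emb : N → V
  isSimplicialIso : IsSimplicialIso (coxeterComplex b) apartment emb

namespace Marking

variable {X : Building b V} (m : X.Marking)

open Classical in
/-- The chamber of the fixed apartment that corresponds to `w`. -/
def chamberAt (w : affineWeylGroup P) : Finset V := (alcoveVertices b w).image m.emb

/-- `τ` extends the type function of the Coxeter complex, and every chamber has exactly one vertex
of each type. -/
def IsTypeFunction (τ : V → Node b) : Prop :=
  (∀ (w : affineWeylGroup P) (i : Node b),
    τ (m.emb ((w : N ≃ᵃ[ℝ] N) (fundamentalVertex b i))) = i) ∧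
  ∀ c, IsChamber X.complex c → Set.BijOn τ c Set.univ

open Classical in
/-- The type function on the vertices of the building (the unique one, on vertices, that
satisfies `IsTypeFunction`). -/
def typeFunction : V → Node b :=
  if h : ∃ τ, m.IsTypeFunction τ then h.choose else fun _ => none

/-- The simplex `p` has vertices of all types except `i`. -/
def HasCotype (p : Finset V) (i : Node b) : Prop :=
  ∀ j, (∃ x ∈ p, m.typeFunction x = j) ↔ j ≠ i

/-- The building is regular: panels of the same cotype lie in equally many chambers. -/
def IsRegular : Prop :=
  ∀ (i : Node b) (p p' : Finset V), IsPanel X.complex p → IsPanel X.complex p' →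
    m.HasCotype p i → m.HasCotype p' i →
    Nonempty ({c // IsChamber X.complex c ∧ p ⊆ c} ≃ {c // IsChamber X.complex c ∧ p' ⊆ c})

/-- The chambers `c` and `d` share a panel of cotype `i`. -/
def Adjacent (i : Node b) (c d : Finset V) : Prop :=
  IsChamber X.complex c ∧ IsChamber X.complex d ∧
    ∃ p, IsPanel X.complex p ∧ m.HasCotype p i ∧ p ⊆ c ∧ p ⊆ d

/-- The chambers `d` with `δ(c, d) = s_i`. -/
def neighbors (i : Node b) (c : Finset V) : Set (Finset V) := {d | m.Adjacent i c d ∧ c ≠ d}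

/-- Galleries of a given type. -/
def IsGallery {l : ℕ} (word : Fin l → Node b) (c : Fin (l + 1) → Finset V) : Prop :=
  (∀ k, IsChamber X.complex (c k)) ∧
    ∀ k : Fin l, m.Adjacent (word k) (c k.castSucc) (c k.succ) ∧ c k.castSucc ≠ c k.succ

/-- The subcomplex `A` contains the part of the fixed apartment that corresponds to the
sector `T`. -/
def ContainsSector (A : PreAbstractSimplicialComplex V) (T : Set N) : Prop :=
  ∀ w : affineWeylGroup P, alcove b w ⊆ T → m.chamberAt w ∈ A

open Classical in
/-- `w` is the image of the chamber `c` under the retraction onto the fixed apartment centred at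
the sector `w_0 C_0`, computed by means of some apartment `A` that contains `c` and a subsector of
`w_0 C_0`. -/
def RetractsTo (c : Finset V) (w : affineWeylGroup P) : Prop :=
  ∃ A ∈ X.apartments, c ∈ A ∧
    (∃ T, IsSector b T ∧ T ⊆ oppositeWeylChamber b ∧ m.ContainsSector A T) ∧
    ∃ f : V → V, IsSimplicialIso A m.apartment f ∧
      (∀ x ∈ vertices (A ⊓ m.apartment), f x = x) ∧ c.image f = m.chamberAt w

open Classical in
/-- The sector retraction `ρ_{-∞}`, from chambers of the building to alcoves. -/
def retraction (c : Finset V) : affineWeylGroup P :=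
  if h : ∃ w, m.RetractsTo c w then h.choose else 1

/-- The galleries of type `word` that start at the chamber `1` and whose last chamber retracts
to `v`. -/
def galleries {l : ℕ} (word : Fin l → Node b) (v : affineWeylGroup P) :
    Set (Fin (l + 1) → Finset V) :=
  {c | m.IsGallery word c ∧ c 0 = m.chamberAt 1 ∧ m.retraction (c (Fin.last l)) = v}

end Marking

end Building

/-! ### Labelled alcove walks -/

/-- One step of type `i` of a labelled positively folded alcove walk, from the alcove `x` to the
alcove `y`, with label `z`: a positive crossing with any label, a positive fold with a nonzero
label, or a negative crossing with label `0`. -/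
def IsLabelledStep (b : P.Base) (q : Node b → Type*) [∀ i, Zero (q i)] (i : Node b)
    (x y : affineWeylGroup P) (z : q i) : Prop :=
  (y = x * simpleReflection b i ∧ IsPositiveCrossing b x (x * simpleReflection b i)) ∨
  (y = x ∧ IsPositiveCrossing b (x * simpleReflection b i) x ∧ z ≠ 0) ∨
  (y = x * simpleReflection b i ∧ IsPositiveCrossing b (x * simpleReflection b i) x ∧ z = 0)

/-- The `q`-labelled positively folded alcove walks of type `word` from the alcove `1` to the
alcove `v`. -/
structure LabelledWalk (b : P.Base) (q : Node b → Type*) [∀ i, Zero (q i)] {l : ℕ}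
    (word : Fin l → Node b) (v : affineWeylGroup P) where
  /-- the alcoves -/
  alcove : Fin (l + 1) → affineWeylGroup P
  /-- the labels -/
  label : ∀ k : Fin l, q (word k)
  start : alcove 0 = 1
  finish : alcove (Fin.last l) = v
  step : ∀ k : Fin l, IsLabelledStep b q (word k) (alcove k.castSucc) (alcove k.succ) (label k)

end AffineBuilding

end

/-!
Fix a chamber `c` with retraction `x`, and a type `i`. If the sector `w₀ C₀` lies on the same side
of the wall of cotype `i` as `x`, i.e. `x → x sᵢ` is a positive crossing, then every `i`-neighbour
of `c` retracts to `x sᵢ`. Otherwise exactly one `i`-neighbour retracts to `x sᵢ`, and all the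
others fold back to `x`. Labelling the neighbours of every chamber, with the label `0` for the
exceptional neighbour in the second case, turns a gallery into a labelled walk; conversely the
labels determine the gallery one chamber at a time.

The retraction is computed through the Weyl distance `δ`: a chamber retracts to `w` if it is the
image of `w` under an isometry of the affine Weyl group into the building that agrees with the
fixed apartment deep inside the sector. As the apartment system is complete, such an isometry is an
apartment.
-/

noncomputable section

namespace AffineBuilding

/-! ### Coefficients of roots and the highest root -/

section Roots

variable {ι M N : Type*} [AddCommGroup M] [Module ℝ M] [AddCommGroup N] [Module ℝ N]
  {P : RootPairing ι ℝ M N}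

theorem pairing_eq_intCast [P.IsCrystallographic] (i j : ι) :
    P.pairing i j = (P.pairingIn ℤ i j : ℝ) := by
  rw [← P.algebraMap_pairingIn ℤ, eq_intCast]

theorem root'_reflectionPerm_self (α : ι) (x : N) :
    P.root' (P.reflectionPerm α α) x = -P.root' α x := by
  simp [RootPairing.root']

variable (b : P.Base)

theorem isPos_reflectionPerm_self_iff (α : ι) :
    b.IsPos (P.reflectionPerm α α) ↔ ¬ b.IsPos α :=
  RootPairing.Base.IsPos.neg_iff_not b α

variable [P.IsRootSystem]

/-- The coefficient of the root `α` in the simple root `i`. -/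
def coeff (α : ι) (i : b.support) : ℝ := b.toWeightBasis.repr (P.root α) i

theorem sum_coeff_smul_root (α : ι) : ∑ i, coeff b α i • P.root i = P.root α := by
  simpa [coeff] using b.toWeightBasis.sum_repr (P.root α)

theorem root'_eq_sum_coeff (α : ι) (x : N) :
    P.root' α x = ∑ i, coeff b α i * P.root' i x := by
  rw [RootPairing.root', ← sum_coeff_smul_root b α]
  simp

theorem pairing_eq_sum_coeff (α β : ι) :
    P.pairing α β = ∑ i : b.support, coeff b α i * P.pairing i β := by
  simpa using root'_eq_sum_coeff b α (P.coroot β)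

theorem coeff_injective : Function.Injective (coeff b) := fun α β h =>
  P.root.injective <| by rw [← sum_coeff_smul_root b α, ← sum_coeff_smul_root b β, h]

theorem coeff_simple (i j : b.support) : coeff b i j = Finsupp.single i (1 : ℝ) j := by
  simp [coeff]

theorem root'_fundamentalCoweight_eq_coeff (α : ι) (i : b.support) :
    P.root' α (fundamentalCoweight b i) = coeff b α i := by
  classical
  rw [root'_eq_sum_coeff b]
  simp [root'_fundamentalCoweight, Finsupp.single_apply]

theorem coeff_reflectionPerm_self (α : ι) (i : b.support) :
    coeff b (P.reflectionPerm α α) i = -coeff b α i := by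
  simp [coeff]

theorem coeff_eq_of_root_eq_sum {α : ι} {f : ι → ℤ}
    (h : P.root α = ∑ j ∈ b.support, f j • P.root j) (i : b.support) :
    coeff b α i = f i := by
  have hα : P.root α = ∑ j : b.support, (f j : ℝ) • b.toWeightBasis j := by
    rw [h, ← b.support.sum_coe_sort]
    exact Finset.sum_congr rfl fun j _ => by simp [Int.cast_smul_eq_zsmul]
  rw [coeff, hα, Module.Basis.repr_sum_self]

theorem exists_int_coeff_eq (α : ι) :
    ∃ f : b.support → ℤ, (∀ i, coeff b α i = f i) ∧ b.height α = ∑ i, f i ∧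
      ((∀ i, 0 ≤ f i) ∨ ∀ i, f i ≤ 0) := by
  obtain ⟨f, -, hsign, hf⟩ := b.exists_root_eq_sum_int α
  refine ⟨fun i => f i, coeff_eq_of_root_eq_sum b hf, ?_,
    hsign.imp (fun h i => h.le i) (fun h i => h.le i)⟩
  rw [RootPairing.Base.height_eq_sum hf, ← b.support.sum_coe_sort]

variable {b}

theorem coeff_nonneg {α : ι} (hα : b.IsPos α) (i : b.support) : 0 ≤ coeff b α i := by
  obtain ⟨f, hf, hheight, hnonneg | hnonpos⟩ := exists_int_coeff_eq b α
  · rw [hf]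
    exact_mod_cast hnonneg i
  · rw [RootPairing.Base.isPos_iff, hheight] at hα
    exact absurd hα (Finset.sum_nonpos fun i _ => hnonpos i).not_gt

theorem coeff_nonpos {α : ι} (hα : ¬ b.IsPos α) (i : b.support) : coeff b α i ≤ 0 := by
  have := coeff_nonneg ((isPos_reflectionPerm_self_iff b α).2 hα) i
  rwa [coeff_reflectionPerm_self, neg_nonneg] at this

theorem exists_one_le_coeff {α : ι} (hα : b.IsPos α) : ∃ i : b.support, 1 ≤ coeff b α i := by
  obtain ⟨f, hf, hheight, -⟩ := exists_int_coeff_eq b α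
  rw [RootPairing.Base.isPos_iff, hheight] at hα
  obtain ⟨i, -, hi⟩ : ∃ i ∈ Finset.univ, 0 < f i :=
    Finset.exists_lt_of_sum_lt (f := fun _ => (0 : ℤ)) (by simpa using hα)
  exact ⟨i, by rw [hf]; exact_mod_cast hi⟩

section Highest

variable (b) in
/-- Maximal roots for the coefficientwise partial order. In an irreducible root system there is
only one of them, the highest root. -/
def IsMaximalRoot (θ : ι) : Prop := ∀ β, coeff b θ ≤ coeff b β → β = θ

variable (b) in
theorem exists_isMaximalRoot_ge [Finite ι] (α : ι) :
    ∃ θ, IsMaximalRoot b θ ∧ coeff b α ≤ coeff b θ := by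
  obtain ⟨_, hle, ⟨θ, rfl⟩, hmax⟩ :=
    (Set.finite_range (coeff b)).exists_le_maximal (Set.mem_range_self α)
  exact ⟨θ, fun β hβ => coeff_injective b ((hmax ⟨β, rfl⟩ hβ).antisymm hβ), hle⟩

namespace IsMaximalRoot

theorem isPos {θ : ι} (h : IsMaximalRoot b θ) : b.IsPos θ := by
  by_contra hθ
  have hneg := (isPos_reflectionPerm_self_iff b θ).2 hθ
  have hle : coeff b θ ≤ coeff b (P.reflectionPerm θ θ) := fun i =>
    (coeff_nonpos hθ i).trans (coeff_nonneg hneg i)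
  exact hθ (h _ hle ▸ hneg)

variable [Finite ι] [P.IsCrystallographic]

theorem pairingIn_nonneg {θ : ι} (h : IsMaximalRoot b θ) {j : ι} (hj : j ∈ b.support) :
    0 ≤ P.pairingIn ℤ θ j := by
  by_contra! hneg
  have hjpos : b.IsPos j := RootPairing.Base.isPos_of_mem_support hj
  have hne : P.root θ ≠ -P.root j := by
    intro he
    have hθ : θ = P.reflectionPerm j j := P.root.injective (by simp [he])
    exact (isPos_reflectionPerm_self_iff b j).1 (hθ ▸ h.isPos) hjpos
  obtain ⟨β, hβ⟩ := P.root_add_root_mem_of_pairingIn_neg hneg hne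
  have hle : coeff b θ ≤ coeff b β := fun i => by
    have hβi : coeff b β i = coeff b θ i + coeff b j i := by simp [coeff, hβ]
    linarith [coeff_nonneg hjpos i]
  obtain rfl := h β hle
  exact P.ne_zero j (by simpa using hβ)

/-- All summands of `⟨θ, α_j^∨⟩ = ∑ i, coeff θ i * ⟨α_i, α_j^∨⟩ ≥ 0` are nonpositive, so they
all vanish. -/
theorem pairing_eq_zero {θ : ι} (h : IsMaximalRoot b θ) {j k : b.support}
    (hj : coeff b θ j = 0) (hk : 0 < coeff b θ k) : P.pairing k j = 0 := by
  have hterm : ∀ i ∈ Finset.univ, coeff b θ i * P.pairing i j ≤ 0 := by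
    intro i _
    obtain rfl | hij := eq_or_ne i j
    · simp [hj]
    · refine mul_nonpos_of_nonneg_of_nonpos (coeff_nonneg h.isPos i) ?_
      rw [pairing_eq_intCast]
      exact_mod_cast b.pairingIn_le_zero_of_ne (Subtype.coe_injective.ne hij) i.2 j.2
  have hsum : 0 ≤ ∑ i : b.support, coeff b θ i * P.pairing i j := by
    rw [← pairing_eq_sum_coeff, pairing_eq_intCast]
    exact_mod_cast h.pairingIn_nonneg j.2
  exact (mul_eq_zero.1 ((Finset.sum_eq_zero_iff_of_nonpos hterm).1
    ((Finset.sum_nonpos hterm).antisymm hsum) k (Finset.mem_univ _))).resolve_left hk.ne'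

variable [P.IsReduced] [P.IsIrreducible]

/-- The span of the simple roots that occur in `θ` is stable under all simple reflections. -/
theorem coeff_pos {θ : ι} (h : IsMaximalRoot b θ) (i : b.support) : 0 < coeff b θ i := by
  let J : Set b.support := {i | 0 < coeff b θ i}
  let q : Submodule ℝ M := Submodule.span ℝ ((fun i : b.support => P.root i) '' J)
  have root_mem : ∀ k ∈ J, P.root k ∈ q := fun k hk => Submodule.subset_span ⟨k, hk, rfl⟩
  have hinv : ∀ j ∈ b.support, q ∈ Module.End.invtSubmodule (P.reflection j) := by
    intro j hj
    rw [Module.End.mem_invtSubmodule]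
    refine Submodule.span_le.2 ?_
    rintro _ ⟨k, hk, rfl⟩
    suffices P.root k - P.pairing k j • P.root j ∈ q by
      simpa [RootPairing.reflection_apply_root] using this
    refine q.sub_mem (root_mem k hk) ?_
    obtain hjJ | hjJ := (coeff_nonneg h.isPos ⟨j, hj⟩).eq_or_lt
    · simp [h.pairing_eq_zero hjJ.symm hk]
    · exact q.smul_mem _ (root_mem ⟨j, hj⟩ hjJ)
  have hq : q = ⊤ := by
    refine RootPairing.IsIrreducible.eq_top_of_invtSubmodule_reflection (P := P) q
      ((b.forall_mem_support_invtSubmodule_iff q).1 hinv) fun hbot => ?_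
    obtain ⟨k, hk⟩ := exists_one_le_coeff h.isPos
    exact P.ne_zero k (by simpa [hbot] using root_mem k (one_pos.trans_le hk))
  by_contra hi
  have hnot := b.toWeightBasis.linearIndependent.notMem_span_image (s := J) (x := i) hi
  simp only [RootPairing.Base.toWeightBasis_apply] at hnot
  exact hnot (show P.root i ∈ q from hq ▸ Submodule.mem_top)

theorem pairingIn_pos {θ θ' : ι} (h : IsMaximalRoot b θ) (h' : IsMaximalRoot b θ') :
    0 < P.pairingIn ℤ θ θ' := by
  have hnonneg : ∀ i : b.support, 0 ≤ P.pairing i θ' := fun i => by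
    have : ¬ P.pairingIn ℤ i θ' < 0 := fun hlt =>
      (h'.pairingIn_nonneg i.2).not_gt ((P.pairingIn_lt_zero_iff ℤ).1 hlt)
    rw [pairing_eq_intCast]
    exact_mod_cast not_lt.1 this
  obtain ⟨j, hj, hj'⟩ := h'.isPos.exists_mem_support_pos_pairingIn
  have hjpos : 0 < P.pairing j θ' := by
    rw [pairing_eq_intCast]
    exact_mod_cast hj'
  have : 0 < P.pairing θ θ' := by
    rw [pairing_eq_sum_coeff (b := b)]
    exact Finset.sum_pos' (fun i _ => mul_nonneg (h.coeff_pos i).le (hnonneg i))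
      ⟨⟨j, hj⟩, Finset.mem_univ _, mul_pos (h.coeff_pos _) hjpos⟩
  rw [pairing_eq_intCast] at this
  exact_mod_cast this

theorem unique {θ θ' : ι} (h : IsMaximalRoot b θ) (h' : IsMaximalRoot b θ') :
    θ = θ' := by
  by_contra hne
  obtain ⟨γ, hγ⟩ := P.root_sub_root_mem_of_pairingIn_pos (h.pairingIn_pos h') hne
  have hcoeff : ∀ i, coeff b γ i = coeff b θ i - coeff b θ' i := fun i => by simp [coeff, hγ]
  by_cases hpos : b.IsPos γ
  · exact hne (h' θ fun i => by linarith [coeff_nonneg hpos i, hcoeff i])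
  · exact hne (h θ' fun i => by linarith [coeff_nonpos hpos i, hcoeff i]).symm

end IsMaximalRoot

variable [Finite ι] [P.IsCrystallographic] [P.IsReduced] [P.IsIrreducible]
  [Nonempty ι] (b)

theorem isHighestRoot_highestRoot : IsHighestRoot b (highestRoot b) := by
  refine Classical.epsilon_spec (p := IsHighestRoot b) ?_
  obtain ⟨θ, hθ, -⟩ := exists_isMaximalRoot_ge b (Classical.arbitrary ι)
  refine ⟨θ, fun i α => ?_⟩
  obtain ⟨θ', hθ', hle⟩ := exists_isMaximalRoot_ge b α
  exact hθ.unique hθ' ▸ hle i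

theorem coeff_le_coeff_highestRoot (α : ι) (i : b.support) :
    coeff b α i ≤ coeff b (highestRoot b) i := isHighestRoot_highestRoot b i α

theorem one_le_coeff_highestRoot (i : b.support) : 1 ≤ coeff b (highestRoot b) i := by
  simpa [coeff_simple] using coeff_le_coeff_highestRoot b i i

theorem isPos_highestRoot : b.IsPos (highestRoot b) := by
  by_contra hneg
  obtain ⟨i⟩ := b.support_nonempty.to_subtype
  linarith [one_le_coeff_highestRoot b i, coeff_nonpos hneg i]

end Highest

end Roots

/-! ### Affine roots and affine reflections -/

section AffineRoots

variable {ι M N : Type*} [AddCommGroup M] [Module ℝ M] [AddCommGroup N] [Module ℝ N]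
  {P : RootPairing ι ℝ M N}

instance : MulAction (affineWeylGroup P) N where
  smul w x := (w : N ≃ᵃ[ℝ] N) x
  one_smul _ := rfl
  mul_smul _ _ _ := rfl

instance : FaithfulSMul (affineWeylGroup P) N where
  eq_of_smul_eq_smul h := Subtype.ext (AffineEquiv.ext h)

variable (P) in
/-- The value at `x` of the affine root `α + kδ`, which is encoded as the pair `f = (α, k)`. -/
def affineEval (f : ι × ℤ) (x : N) : ℝ := P.root' f.1 x + (f.2 : ℝ)

variable (P) in
/-- The reflection in the zero set of an affine root, as an element of the affine Weyl group. -/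
def weylReflection (f : ι × ℤ) : affineWeylGroup P :=
  ⟨affineReflection P f.1 f.2, Subgroup.subset_closure ⟨f, rfl⟩⟩

theorem weylReflection_smul (f : ι × ℤ) (x : N) :
    weylReflection P f • x = x - affineEval P f x • P.coroot f.1 :=
  affineReflection_apply P f.1 f.2 x

theorem affineEval_sub_smul (f : ι × ℤ) (x y : N) (c : ℝ) :
    affineEval P f (x - c • y) = affineEval P f x - c * P.root' f.1 y := by
  simp only [affineEval, map_sub, map_smul, smul_eq_mul]
  ring

theorem affineEval_add_smul_sub (f : ι × ℤ) (x y : N) (t : ℝ) :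
    affineEval P f (x + t • (y - x)) = (1 - t) * affineEval P f x + t * affineEval P f y := by
  simp only [affineEval, map_add, map_smul, map_sub, smul_eq_mul]
  ring

theorem affineEval_weylReflection_self (f : ι × ℤ) (x : N) :
    affineEval P f (weylReflection P f • x) = -affineEval P f x := by
  rw [weylReflection_smul, affineEval_sub_smul, RootPairing.root'_coroot_eq_pairing,
    RootPairing.pairing_same]
  ring

theorem weylReflection_mul_self (f : ι × ℤ) : weylReflection P f * weylReflection P f = 1 := by
  refine eq_of_smul_eq_smul fun x : N => ?_
  rw [mul_smul, one_smul, weylReflection_smul, affineEval_weylReflection_self, weylReflection_smul]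
  module

theorem weylReflection_inv (f : ι × ℤ) : (weylReflection P f)⁻¹ = weylReflection P f :=
  inv_eq_of_mul_eq_one_left (weylReflection_mul_self f)

theorem affineWeylGroup_induction {p : affineWeylGroup P → Prop} (one : p 1)
    (mul_weylReflection : ∀ w f, p w → p (w * weylReflection P f)) (w : affineWeylGroup P) :
    p w := by
  obtain ⟨w, hw⟩ := w
  induction hw using Subgroup.closure_induction_right with
  | one => exact one
  | mul_right w hw s hs ih =>
    obtain ⟨f, rfl⟩ := hs
    exact mul_weylReflection ⟨w, hw⟩ f ih
  | mul_inv_cancel w hw s hs ih =>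
    obtain ⟨f, rfl⟩ := hs
    have := mul_weylReflection ⟨w, hw⟩ f ih
    rwa [← weylReflection_inv] at this

variable (P) in
/-- The affine root `-f`. -/
def oppositeRoot (f : ι × ℤ) : ι × ℤ := (P.reflectionPerm f.1 f.1, -f.2)

theorem affineEval_oppositeRoot (f : ι × ℤ) (x : N) :
    affineEval P (oppositeRoot P f) x = -affineEval P f x := by
  simp only [affineEval, oppositeRoot, root'_reflectionPerm_self, Int.cast_neg]
  ring

theorem weylReflection_oppositeRoot (f : ι × ℤ) :
    weylReflection P (oppositeRoot P f) = weylReflection P f := by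
  refine eq_of_smul_eq_smul fun x : N => ?_
  rw [weylReflection_smul, weylReflection_smul, affineEval_oppositeRoot]
  simp [oppositeRoot]

section Reflected

variable [P.IsCrystallographic]

variable (P) in
/-- The affine root `f ∘ s`, where `s` is the reflection in the zero set of `h`. -/
def reflectedRoot (h f : ι × ℤ) : ι × ℤ :=
  (P.reflectionPerm h.1 f.1, f.2 - h.2 * P.pairingIn ℤ f.1 h.1)

theorem affineEval_reflectedRoot (h f : ι × ℤ) (x : N) :
    affineEval P (reflectedRoot P h f) x = affineEval P f (weylReflection P h • x) := by
  rw [weylReflection_smul, affineEval_sub_smul, RootPairing.root'_coroot_eq_pairing,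
    pairing_eq_intCast]
  simp only [affineEval, reflectedRoot, RootPairing.root', RootPairing.root_reflectionPerm,
    RootPairing.reflection_apply_root, map_sub, map_smul, LinearMap.sub_apply,
    LinearMap.smul_apply, smul_eq_mul, Int.cast_sub, Int.cast_mul, pairing_eq_intCast]
  ring

theorem reflectedRoot_injective (h : ι × ℤ) : Function.Injective (reflectedRoot P h) := by
  rintro ⟨α, k⟩ ⟨β, l⟩ hf
  simp only [reflectedRoot, Prod.mk.injEq, EmbeddingLike.apply_eq_iff_eq] at hf
  obtain ⟨rfl, hkl⟩ := hf
  simpa using hkl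

theorem weylReflection_reflectedRoot (h f : ι × ℤ) :
    weylReflection P (reflectedRoot P h f) =
      weylReflection P h * weylReflection P f * weylReflection P h := by
  refine eq_of_smul_eq_smul fun x : N => ?_
  obtain ⟨y, rfl⟩ : ∃ y, weylReflection P h • y = x :=
    ⟨weylReflection P h • x, by rw [← mul_smul, weylReflection_mul_self, one_smul]⟩
  have hy : weylReflection P h • weylReflection P h • y = y := by
    rw [← mul_smul, weylReflection_mul_self, one_smul]
  rw [mul_smul, mul_smul, weylReflection_smul (reflectedRoot P h f), affineEval_reflectedRoot, hy,
    weylReflection_smul f, weylReflection_smul h (y - _), weylReflection_smul h y,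
    affineEval_sub_smul]
  simp only [reflectedRoot, RootPairing.coroot_reflectionPerm, RootPairing.coreflection_apply]
  module

theorem exists_affineEval_smul (w : affineWeylGroup P) (f : ι × ℤ) :
    ∃ g, (∀ x, affineEval P g x = affineEval P f (w • x)) ∧
      weylReflection P g = w⁻¹ * weylReflection P f * w := by
  induction w using affineWeylGroup_induction with
  | one => exact ⟨f, fun x => by rw [one_smul], by group⟩
  | mul_weylReflection w h ih =>
    obtain ⟨g, hg, hg'⟩ := ih
    refine ⟨reflectedRoot P h g, fun x => ?_, ?_⟩
    · rw [affineEval_reflectedRoot, hg, mul_smul]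
    · rw [weylReflection_reflectedRoot, hg', mul_inv_rev, weylReflection_inv]
      group

end Reflected

theorem eq_of_affineEval_eq_mul [P.IsReduced] {f g : ι × ℤ} {c : ℝ} (hc : 0 < c)
    (h : ∀ x, affineEval P f x = c * affineEval P g x) : f = g := by
  have hconst : (f.2 : ℝ) = c * g.2 := by simpa [affineEval] using h 0
  have hroot : P.root f.1 = c • P.root g.1 := by
    apply P.toPerfPair.injective
    ext x
    have hx := h x
    simp only [affineEval] at hx
    have : P.root' f.1 x = c * P.root' g.1 x := by linear_combination hx - hconst
    simpa using this
  have smul_inj {c' : ℝ} (h' : c • P.root g.1 = c' • P.root g.1) : c = c' :=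
    smul_left_injective ℝ (P.ne_zero _) h'
  have hdep : ¬ LinearIndependent ℝ ![P.root f.1, P.root g.1] := fun hli =>
    one_ne_zero (LinearIndependent.pair_iff.1 hli 1 (-c) (by rw [hroot]; module)).1
  obtain he | he := RootPairing.IsReduced.eq_or_eq_neg (P := P) _ _ hdep
  · obtain rfl : c = 1 := smul_inj (by rw [← hroot, he, one_smul])
    exact Prod.ext (P.root.injective he) (by exact_mod_cast hconst.trans (one_mul _))
  · have : c = -1 := smul_inj (by rw [← hroot, he, neg_smul, one_smul])
    linarith

end AffineRoots

/-! ### The fundamental alcove -/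

section Alcoves

variable {ι M N : Type*} [AddCommGroup M] [Module ℝ M] [AddCommGroup N] [Module ℝ N]
  {P : RootPairing ι ℝ M N} [P.IsRootSystem] [Nonempty ι] (b : P.Base)

/-- The affine roots `α_0 = -θ + δ, α_1, …, α_n`, whose zero sets are the walls of the fundamental
alcove. -/
def wall : Node b → ι × ℤ
  | none => (P.reflectionPerm (highestRoot b) (highestRoot b), 1)
  | some i => (i, 0)

/-- The coefficients of the highest root in the simple roots, together with `1` at the node `0`;
they are the coefficients of the constant function `1` in the affine simple roots. -/
def mark : Node b → ℝ
  | none => 1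
  | some i => coeff b (highestRoot b) i

theorem affineEval_wall_none (x : N) :
    affineEval P (wall b none) x = 1 - P.root' (highestRoot b) x := by
  simp only [affineEval, wall, root'_reflectionPerm_self, Int.cast_one]
  ring

theorem affineEval_wall_some (i : b.support) (x : N) :
    affineEval P (wall b (some i)) x = P.root' i x := by
  simp [affineEval, wall]

theorem simpleReflection_eq_weylReflection (i : Node b) :
    simpleReflection b i = weylReflection P (wall b i) := by
  cases i with
  | none =>
    have hwall : wall b none = oppositeRoot P (highestRoot b, -1) := by simp [wall, oppositeRoot]
    rw [hwall, weylReflection_oppositeRoot]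
    rfl
  | some i => rfl

theorem simpleReflection_mul_self (i : Node b) :
    simpleReflection b i * simpleReflection b i = 1 := by
  rw [simpleReflection_eq_weylReflection, weylReflection_mul_self]

theorem mem_fundamentalAlcove_iff (x : N) :
    x ∈ fundamentalAlcove b ↔ ∀ i, 0 < affineEval P (wall b i) x := by
  rw [Option.forall, affineEval_wall_none, and_comm, sub_eq_neg_add]
  simp only [affineEval_wall_some]
  rfl

theorem affineEval_fundamentalVertex_none (f : ι × ℤ) :
    affineEval P f (fundamentalVertex b none) = f.2 := by
  simp [affineEval, fundamentalVertex]

theorem affineEval_fundamentalVertex_some (f : ι × ℤ) (i : b.support) :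
    affineEval P f (fundamentalVertex b (some i)) = (mark b (some i))⁻¹ * coeff b f.1 i + f.2 := by
  simp only [affineEval, fundamentalVertex, map_smul, root'_fundamentalCoweight_eq_coeff,
    smul_eq_mul, mark, coeff]

theorem affineEval_wall_fundamentalVertex_self (i : Node b) :
    affineEval P (wall b i) (fundamentalVertex b i) = (mark b i)⁻¹ := by
  cases i with
  | none => simp [affineEval_fundamentalVertex_none, wall, mark]
  | some i => simp [affineEval_fundamentalVertex_some, wall, coeff_simple]

variable [Finite ι] [P.IsCrystallographic] [P.IsReduced] [P.IsIrreducible]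

theorem mark_pos (i : Node b) : 0 < mark b i := by
  cases i with
  | none => exact one_pos
  | some i => exact one_pos.trans_le (one_le_coeff_highestRoot b i)

theorem affineEval_wall_fundamentalVertex_of_ne {i j : Node b} (h : i ≠ j) :
    affineEval P (wall b i) (fundamentalVertex b j) = 0 := by
  match i, j with
  | none, none => exact absurd rfl h
  | none, some j =>
    have hj : (mark b (some j))⁻¹ * coeff b (highestRoot b) j = 1 :=
      inv_mul_cancel₀ (mark_pos b (some j)).ne'
    rw [affineEval_fundamentalVertex_some, wall, coeff_reflectionPerm_self, mul_neg, hj]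
    simp
  | some i, none => simp [affineEval_fundamentalVertex_none, wall]
  | some i, some j =>
    have hij : i ≠ j := fun e => h (by rw [e])
    simp [affineEval_fundamentalVertex_some, wall, coeff_simple, hij]

/-- The numbers `mark b i * affineEval P (wall b i) x` are the barycentric coordinates of `x` with
respect to the vertices of the fundamental alcove. -/
theorem affineEval_eq_sum (f : ι × ℤ) (x : N) :
    affineEval P f x =
      ∑ i, affineEval P f (fundamentalVertex b i) * (mark b i * affineEval P (wall b i) x) := by
  have hterm : ∀ i : b.support, affineEval P f (fundamentalVertex b (some i)) *
      (mark b (some i) * affineEval P (wall b (some i)) x) =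
      coeff b f.1 i * P.root' i x + f.2 * (coeff b (highestRoot b) i * P.root' i x) := by
    intro i
    have hi := (mark_pos b (some i)).ne'
    rw [affineEval_fundamentalVertex_some, affineEval_wall_some,
      show coeff b (highestRoot b) i = mark b (some i) from rfl]
    field_simp
  rw [Fintype.sum_option, affineEval_fundamentalVertex_none, affineEval_wall_none]
  simp only [hterm, Finset.sum_add_distrib, ← Finset.mul_sum, ← root'_eq_sum_coeff]
  simp only [affineEval, mark]
  ring

/-- A point of the fundamental alcove. -/
def basePoint : N :=
  ∑ i, (1 + ∑ j, coeff b (highestRoot b) j)⁻¹ • fundamentalCoweight b i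

theorem basePoint_mem : basePoint b ∈ fundamentalAlcove b := by
  have hs : 0 ≤ ∑ j, coeff b (highestRoot b) j :=
    Finset.sum_nonneg fun j _ => coeff_nonneg (isPos_highestRoot b) j
  have hroot : ∀ α, P.root' α (basePoint b) =
      (1 + ∑ j, coeff b (highestRoot b) j)⁻¹ * ∑ j, coeff b α j := fun α => by
    simp only [basePoint, map_sum, map_smul, root'_fundamentalCoweight_eq_coeff, smul_eq_mul,
      Finset.mul_sum]
  refine (mem_fundamentalAlcove_iff b _).2 (Option.forall.2 ⟨?_, fun i => ?_⟩)
  · rw [affineEval_wall_none, hroot, sub_pos, inv_mul_lt_one₀ (by linarith)]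
    linarith
  · have hi : ∑ j, coeff b i j = 1 := by
      classical
      simp [coeff_simple, Finsupp.single_apply]
    rw [affineEval_wall_some, hroot, hi]
    positivity

theorem affineEval_wall_basePoint_pos (i : Node b) : 0 < affineEval P (wall b i) (basePoint b) :=
  (mem_fundamentalAlcove_iff b _).1 (basePoint_mem b) i

variable {b}

theorem root'_mem_Ioo_of_mem {x : N} (hx : x ∈ fundamentalAlcove b) {α : ι} (hα : b.IsPos α) :
    P.root' α x ∈ Set.Ioo (0 : ℝ) 1 := by
  obtain ⟨hsimple, hhighest⟩ := hx
  obtain ⟨i, hi⟩ := exists_one_le_coeff hα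
  constructor
  · rw [root'_eq_sum_coeff b]
    exact Finset.sum_pos' (fun j _ => mul_nonneg (coeff_nonneg hα j) (hsimple j).le)
      ⟨i, Finset.mem_univ _, mul_pos (by linarith) (hsimple i)⟩
  · have : P.root' α x ≤ P.root' (highestRoot b) x := by
      rw [root'_eq_sum_coeff b, root'_eq_sum_coeff b (highestRoot b)]
      exact Finset.sum_le_sum fun j _ =>
        mul_le_mul_of_nonneg_right (coeff_le_coeff_highestRoot b α j) (hsimple j).le
    linarith

variable (b) in
theorem affineEval_pos_or_neg (f : ι × ℤ) :
    (∀ x ∈ fundamentalAlcove b, 0 < affineEval P f x) ∨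
      ∀ x ∈ fundamentalAlcove b, affineEval P f x < 0 := by
  have of_isPos : ∀ g : ι × ℤ, b.IsPos g.1 →
      (∀ x ∈ fundamentalAlcove b, 0 < affineEval P g x) ∨
        ∀ x ∈ fundamentalAlcove b, affineEval P g x < 0 := by
    rintro ⟨α, k⟩ hα
    simp only [affineEval]
    rcases le_or_gt 0 k with hk | hk
    · have hk' : (0 : ℝ) ≤ k := by exact_mod_cast hk
      exact .inl fun x hx => by linarith [(root'_mem_Ioo_of_mem hx hα).1]
    · have hk' : (k : ℝ) ≤ -1 := by exact_mod_cast Int.le_sub_one_of_lt hk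
      exact .inr fun x hx => by linarith [(root'_mem_Ioo_of_mem hx hα).2]
  by_cases h : b.IsPos f.1
  · exact of_isPos f h
  · have := of_isPos (oppositeRoot P f) ((isPos_reflectionPerm_self_iff b f.1).2 h)
    simpa only [affineEval_oppositeRoot, neg_pos, neg_lt_zero] using this.symm

theorem affineEval_ne_zero {x : N} (hx : x ∈ fundamentalAlcove b) (f : ι × ℤ) :
    affineEval P f x ≠ 0 :=
  (affineEval_pos_or_neg b f).elim (fun h => (h x hx).ne') (fun h => (h x hx).ne)

theorem affineEval_pos_iff {x y : N} (hx : x ∈ fundamentalAlcove b)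
    (hy : y ∈ fundamentalAlcove b) (f : ι × ℤ) :
    0 < affineEval P f x ↔ 0 < affineEval P f y := by
  rcases affineEval_pos_or_neg b f with h | h
  · exact iff_of_true (h x hx) (h y hy)
  · exact iff_of_false (h x hx).not_gt (h y hy).not_gt

theorem affineEval_neg_iff {x y : N} (hx : x ∈ fundamentalAlcove b)
    (hy : y ∈ fundamentalAlcove b) (f : ι × ℤ) :
    affineEval P f x < 0 ↔ affineEval P f y < 0 := by
  simpa only [affineEval_oppositeRoot, neg_pos] using affineEval_pos_iff hx hy (oppositeRoot P f)

theorem fundamentalVertex_add_smul_mem {x : N} (hx : x ∈ fundamentalAlcove b) (i : Node b) {t : ℝ}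
    (ht : 0 < t) (ht' : t ≤ 1) :
    fundamentalVertex b i + t • (x - fundamentalVertex b i) ∈ fundamentalAlcove b := by
  rw [mem_fundamentalAlcove_iff] at hx ⊢
  intro j
  have hj : 0 ≤ affineEval P (wall b j) (fundamentalVertex b i) := by
    obtain rfl | hij := eq_or_ne j i
    · rw [affineEval_wall_fundamentalVertex_self]
      exact (inv_pos.2 (mark_pos b j)).le
    · rw [affineEval_wall_fundamentalVertex_of_ne b hij]
  rw [affineEval_add_smul_sub]
  linarith [mul_pos ht (hx j), mul_nonneg (sub_nonneg.2 ht') hj]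

theorem affineEval_fundamentalVertex_nonneg {x : N} (hx : x ∈ fundamentalAlcove b) {f : ι × ℤ}
    (h : 0 < affineEval P f x) (i : Node b) : 0 ≤ affineEval P f (fundamentalVertex b i) := by
  by_contra! hneg
  set v := fundamentalVertex b i
  have hdiff : 0 < affineEval P f x - affineEval P f v := by linarith
  -- `f` vanishes at the point of the segment from `v` to `x` with parameter `t`.
  let t : ℝ := -affineEval P f v / (affineEval P f x - affineEval P f v)
  have hmem : v + t • (x - v) ∈ fundamentalAlcove b :=
    fundamentalVertex_add_smul_mem hx i (div_pos (neg_pos.2 hneg) hdiff)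
      ((div_le_one hdiff).2 (by linarith))
  refine affineEval_ne_zero hmem f ?_
  rw [affineEval_add_smul_sub]
  simp only [t]
  field_simp
  ring

theorem simpleReflection_smul_fundamentalVertex {i j : Node b} (h : i ≠ j) :
    simpleReflection b i • fundamentalVertex b j = fundamentalVertex b j := by
  rw [simpleReflection_eq_weylReflection, weylReflection_smul,
    affineEval_wall_fundamentalVertex_of_ne b h, zero_smul, sub_zero]

/-- An affine root that changes sign between the fundamental alcove and its image under `s_i`
vanishes at the vertices common to both, so it is a multiple of `wall b i`. -/
theorem eq_wall_of_separates {f : ι × ℤ} {i : Node b} (h : 0 < affineEval P f (basePoint b))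
    (h' : affineEval P f (simpleReflection b i • basePoint b) < 0) : f = wall b i := by
  have hvanish : ∀ j, j ≠ i → affineEval P f (fundamentalVertex b j) = 0 := by
    intro j hj
    have hneg : ∀ x, affineEval P (oppositeRoot P (reflectedRoot P (wall b i) f)) x =
        -affineEval P f (simpleReflection b i • x) := fun x => by
      rw [affineEval_oppositeRoot, affineEval_reflectedRoot, simpleReflection_eq_weylReflection]
    have := affineEval_fundamentalVertex_nonneg (basePoint_mem b)
      (by rwa [hneg, neg_pos]) j
    rw [hneg, simpleReflection_smul_fundamentalVertex hj.symm, neg_nonneg] at this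
    exact this.antisymm (affineEval_fundamentalVertex_nonneg (basePoint_mem b) h j)
  let c := affineEval P f (fundamentalVertex b i) * mark b i
  have hc : ∀ x, affineEval P f x = c * affineEval P (wall b i) x := fun x => by
    rw [affineEval_eq_sum b f x,
      Finset.sum_eq_single i (fun j _ hj => by rw [hvanish j hj, zero_mul]) (by simp), mul_assoc]
  refine eq_of_affineEval_eq_mul ?_ hc
  rw [hc] at h
  exact pos_of_mul_pos_left h (affineEval_wall_basePoint_pos b i).le

end Alcoves

/-! ### The length function -/

section Length

variable {ι M N : Type*} [AddCommGroup M] [Module ℝ M] [AddCommGroup N] [Module ℝ N]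
  {P : RootPairing ι ℝ M N}

variable (P) in
/-- The points that lie on no affine hyperplane. -/
def IsRegularPoint (x : N) : Prop := ∀ f, affineEval P f x ≠ 0

theorem IsRegularPoint.smul [P.IsCrystallographic] {x : N} (hx : IsRegularPoint P x)
    (w : affineWeylGroup P) : IsRegularPoint P (w • x) := fun f => by
  obtain ⟨g, hg, -⟩ := exists_affineEval_smul w f
  rw [← hg]
  exact hx g

variable [P.IsRootSystem] [Nonempty ι] (b : P.Base)

/-- The element of the affine Weyl group spelled by a list of nodes. -/
def listProd (L : List (Node b)) : affineWeylGroup P := (L.map (simpleReflection b)).prod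

/-- The length of an element of the affine Weyl group with respect to the Coxeter generators. -/
def length (w : affineWeylGroup P) : ℕ := sInf {n | ∃ L, listProd b L = w ∧ L.length = n}

/-- The affine roots that are positive on the fundamental alcove and negative at `x`. -/
def inversions (x : N) : Set (ι × ℤ) :=
  {f | 0 < affineEval P f (basePoint b) ∧ affineEval P f x < 0}

theorem finite_inversions [Finite ι] (x : N) : (inversions b x).Finite := by
  have : inversions b x ⊆ ⋃ α : ι, (fun k : ℤ => (α, k)) ''
      Set.Icc ⌊-P.root' α (basePoint b)⌋ ⌈-P.root' α x⌉ := by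
    rintro ⟨α, k⟩ ⟨hbase, hx⟩
    simp only [affineEval] at hbase hx
    refine Set.mem_iUnion.2 ⟨α, k, ⟨?_, ?_⟩, rfl⟩
    · exact Int.floor_le_iff.2 (by linarith)
    · exact Int.le_ceil_iff.2 (by linarith)
  exact (Set.finite_iUnion fun α => (Set.finite_Icc _ _).image _).subset this

variable {b}

theorem listProd_nil : listProd b [] = 1 := rfl

theorem listProd_cons (i : Node b) (L : List (Node b)) :
    listProd b (i :: L) = simpleReflection b i * listProd b L := by
  simp [listProd]

theorem listProd_append (L L' : List (Node b)) :
    listProd b (L ++ L') = listProd b L * listProd b L' := by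
  simp [listProd]

theorem simpleReflection_inv (i : Node b) : (simpleReflection b i)⁻¹ = simpleReflection b i :=
  inv_eq_of_mul_eq_one_left (simpleReflection_mul_self b i)

theorem simpleReflection_mul_cancel_left (i : Node b) (w : affineWeylGroup P) :
    simpleReflection b i * (simpleReflection b i * w) = w := by
  rw [← mul_assoc, simpleReflection_mul_self, one_mul]

theorem simpleReflection_mul_cancel_right (w : affineWeylGroup P) (i : Node b) :
    w * simpleReflection b i * simpleReflection b i = w := by
  rw [mul_assoc, simpleReflection_mul_self, mul_one]

theorem listProd_reverse (L : List (Node b)) : listProd b L.reverse = (listProd b L)⁻¹ := by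
  induction L with
  | nil => simp [listProd_nil]
  | cons i L ih =>
    rw [List.reverse_cons, listProd_append, ih, listProd_cons, listProd_cons, listProd_nil,
      mul_inv_rev, mul_one, simpleReflection_inv]

theorem length_listProd_le (L : List (Node b)) : length b (listProd b L) ≤ L.length :=
  Nat.sInf_le ⟨L, rfl, rfl⟩

theorem length_one : length b (1 : affineWeylGroup P) = 0 :=
  Nat.le_zero.1 (length_listProd_le [])

variable [Finite ι] [P.IsCrystallographic] [P.IsReduced] [P.IsIrreducible]

theorem isRegularPoint_of_mem {x : N} (hx : x ∈ fundamentalAlcove b) : IsRegularPoint P x :=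
  affineEval_ne_zero hx

variable (b) in
theorem isRegularPoint_smul_basePoint (w : affineWeylGroup P) :
    IsRegularPoint P (w • basePoint b) :=
  (isRegularPoint_of_mem (basePoint_mem b)).smul w

theorem reflectedRoot_mem_inversions {x : N} {i : Node b} (h : affineEval P (wall b i) x < 0)
    {f : ι × ℤ} (hf : f ∈ inversions b (simpleReflection b i • x)) :
    reflectedRoot P (wall b i) f ∈ inversions b x \ {wall b i} := by
  obtain ⟨hbase, hx⟩ := hf
  have heval : ∀ y, affineEval P (reflectedRoot P (wall b i) f) y =
      affineEval P f (simpleReflection b i • y) := fun y => by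
    rw [affineEval_reflectedRoot, simpleReflection_eq_weylReflection]
  refine ⟨⟨?_, by rwa [heval]⟩, fun hwall => ?_⟩
  · rw [heval]
    by_contra hneg
    obtain rfl := eq_wall_of_separates hbase
      ((not_lt.1 hneg).lt_of_ne (isRegularPoint_smul_basePoint b _ f))
    rw [simpleReflection_eq_weylReflection, affineEval_weylReflection_self] at hx
    linarith
  · have := heval (simpleReflection b i • basePoint b)
    rw [Set.mem_singleton_iff.1 hwall, ← mul_smul, simpleReflection_mul_self, one_smul,
      simpleReflection_eq_weylReflection, affineEval_weylReflection_self] at this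
    linarith [affineEval_wall_basePoint_pos b i]

theorem ncard_inversions_smul_lt {x : N} {i : Node b} (h : affineEval P (wall b i) x < 0) :
    (inversions b (simpleReflection b i • x)).ncard < (inversions b x).ncard :=
  calc (inversions b (simpleReflection b i • x)).ncard
      ≤ (inversions b x \ {wall b i}).ncard :=
        Set.ncard_le_ncard_of_injOn (reflectedRoot P (wall b i))
          (fun _ => reflectedRoot_mem_inversions h) (reflectedRoot_injective _).injOn
          (finite_inversions b x).sdiff
    _ < (inversions b x).ncard :=
        Set.ncard_sdiff_singleton_lt_of_mem ⟨affineEval_wall_basePoint_pos b i, h⟩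
          (finite_inversions b x)

variable (b) in
theorem exists_listProd_smul_mem {x : N} (hx : IsRegularPoint P x) :
    ∃ L, listProd b L • x ∈ fundamentalAlcove b := by
  induction h : (inversions b x).ncard using Nat.strong_induction_on generalizing x with
  | _ n ih =>
    by_cases hmem : x ∈ fundamentalAlcove b
    · exact ⟨[], by rwa [listProd_nil, one_smul]⟩
    · rw [mem_fundamentalAlcove_iff] at hmem
      push Not at hmem
      obtain ⟨i, hi⟩ := hmem
      have hlt := ncard_inversions_smul_lt (hi.lt_of_ne (hx _))
      obtain ⟨L, hL⟩ := ih _ (h ▸ hlt) (hx.smul (simpleReflection b i)) rfl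
      refine ⟨L ++ [i], ?_⟩
      rwa [listProd_append, listProd_cons, listProd_nil, mul_one, mul_smul]

theorem strong_exchange (L : List (Node b)) (f : ι × ℤ)
    (hf : f ∈ inversions b (listProd b L • basePoint b)) :
    ∃ k < L.length, weylReflection P f * listProd b L = listProd b (L.eraseIdx k) := by
  induction L generalizing f with
  | nil =>
    rw [listProd_nil, one_smul] at hf
    exact absurd hf.1 hf.2.not_gt
  | cons i L ih =>
    by_cases hi : affineEval P f (simpleReflection b i • basePoint b) < 0
    · refine ⟨0, by simp, ?_⟩
      rw [eq_wall_of_separates hf.1 hi, ← simpleReflection_eq_weylReflection, listProd_cons,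
        simpleReflection_mul_cancel_left, List.eraseIdx_cons_zero]
    · obtain ⟨g, hg, hg'⟩ := exists_affineEval_smul (simpleReflection b i) f
      have hgL : g ∈ inversions b (listProd b L • basePoint b) := by
        refine ⟨?_, ?_⟩
        · rw [hg]
          exact (not_lt.1 hi).lt_of_ne (isRegularPoint_smul_basePoint b _ f).symm
        · rw [hg, ← mul_smul, ← listProd_cons]
          exact hf.2
      obtain ⟨k, hk, hk'⟩ := ih g hgL
      refine ⟨k + 1, by simpa using hk, ?_⟩
      rw [List.eraseIdx_cons_succ, listProd_cons, listProd_cons, ← hk', hg']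
      group

theorem exists_listProd_eq_weylReflection (f : ι × ℤ) :
    ∃ L, listProd b L = weylReflection P f := by
  wlog hf : 0 < affineEval P f (basePoint b) generalizing f
  · obtain ⟨L, hL⟩ := this (oppositeRoot P f) <| by
      rw [affineEval_oppositeRoot, neg_pos]
      exact (not_lt.1 hf).lt_of_ne (affineEval_ne_zero (basePoint_mem b) f)
    exact ⟨L, by rw [hL, weylReflection_oppositeRoot]⟩
  obtain ⟨L, hL⟩ := exists_listProd_smul_mem b
    (isRegularPoint_smul_basePoint b (weylReflection P f))
  have hinv : f ∈ inversions b (listProd b L.reverse • basePoint b) := by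
    refine ⟨hf, ?_⟩
    obtain ⟨g, hg, -⟩ := exists_affineEval_smul (listProd b L)⁻¹ f
    rw [listProd_reverse, ← hg, affineEval_neg_iff (basePoint_mem b) hL, hg, inv_smul_smul,
      affineEval_weylReflection_self]
    linarith
  obtain ⟨k, -, hk⟩ := strong_exchange L.reverse f hinv
  refine ⟨L.reverse.eraseIdx k ++ L, ?_⟩
  rw [listProd_append, ← hk, listProd_reverse, inv_mul_cancel_right]

variable (b)

theorem exists_listProd_eq (w : affineWeylGroup P) : ∃ L, listProd b L = w := by
  induction w using affineWeylGroup_induction with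
  | one => exact ⟨[], rfl⟩
  | mul_weylReflection w f ih =>
    obtain ⟨L, hL⟩ := ih
    obtain ⟨L', hL'⟩ := exists_listProd_eq_weylReflection (b := b) f
    exact ⟨L ++ L', by rw [listProd_append, hL, hL']⟩

theorem exists_listProd_eq_length_eq (w : affineWeylGroup P) :
    ∃ L, listProd b L = w ∧ L.length = length b w :=
  Nat.sInf_mem (s := {n | ∃ L, listProd b L = w ∧ L.length = n})
    ((exists_listProd_eq b w).elim fun L hL => ⟨_, L, hL, rfl⟩)

variable {b}

theorem length_inv (w : affineWeylGroup P) : length b w⁻¹ = length b w := by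
  have hle : ∀ w : affineWeylGroup P, length b w⁻¹ ≤ length b w := by
    intro w
    obtain ⟨L, rfl, hL⟩ := exists_listProd_eq_length_eq b w
    rw [← hL, ← listProd_reverse, ← L.length_reverse]
    exact length_listProd_le _
  exact (hle w).antisymm (by simpa using hle w⁻¹)

theorem length_simpleReflection_mul_le (i : Node b) (w : affineWeylGroup P) :
    length b (simpleReflection b i * w) ≤ length b w + 1 := by
  obtain ⟨L, rfl, hL⟩ := exists_listProd_eq_length_eq b w
  rw [← hL, ← listProd_cons]
  exact length_listProd_le _

theorem exists_length_simpleReflection_mul_lt {w : affineWeylGroup P} (h : w ≠ 1) :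
    ∃ i, length b (simpleReflection b i * w) < length b w := by
  obtain ⟨L, rfl, hL⟩ := exists_listProd_eq_length_eq b w
  cases L with
  | nil => exact absurd rfl h
  | cons i L =>
    refine ⟨i, ?_⟩
    rw [← hL, listProd_cons, simpleReflection_mul_cancel_left, List.length_cons]
    exact Nat.lt_succ_of_le (length_listProd_le L)

theorem length_weylReflection_mul_lt {f : ι × ℤ} {w : affineWeylGroup P}
    (hf : f ∈ inversions b (w • basePoint b)) :
    length b (weylReflection P f * w) < length b w := by
  obtain ⟨L, rfl, hL⟩ := exists_listProd_eq_length_eq b w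
  obtain ⟨k, hk, heq⟩ := strong_exchange L f hf
  rw [heq, ← hL]
  refine (length_listProd_le _).trans_lt ?_
  rw [List.length_eraseIdx_of_lt hk]
  omega

theorem length_simpleReflection_mul_lt {i : Node b} {w : affineWeylGroup P}
    (h : affineEval P (wall b i) (w • basePoint b) < 0) :
    length b (simpleReflection b i * w) < length b w := by
  rw [simpleReflection_eq_weylReflection]
  exact length_weylReflection_mul_lt ⟨affineEval_wall_basePoint_pos b i, h⟩

theorem length_lt_simpleReflection_mul {i : Node b} {w : affineWeylGroup P}
    (h : 0 < affineEval P (wall b i) (w • basePoint b)) :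
    length b w < length b (simpleReflection b i * w) := by
  have := length_simpleReflection_mul_lt (i := i) (w := simpleReflection b i * w) <| by
    rw [mul_smul, simpleReflection_eq_weylReflection, affineEval_weylReflection_self]
    linarith
  rwa [simpleReflection_mul_cancel_left] at this

theorem length_simpleReflection_mul_lt_iff {i : Node b} {w : affineWeylGroup P} :
    length b (simpleReflection b i * w) < length b w ↔
      affineEval P (wall b i) (w • basePoint b) < 0 := by
  refine ⟨fun h => ?_, length_simpleReflection_mul_lt⟩
  by_contra hn
  exact h.not_gt <| length_lt_simpleReflection_mul <|
    (not_lt.1 hn).lt_of_ne (isRegularPoint_smul_basePoint b w _).symm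

theorem length_lt_simpleReflection_mul_iff {i : Node b} {w : affineWeylGroup P} :
    length b w < length b (simpleReflection b i * w) ↔
      0 < affineEval P (wall b i) (w • basePoint b) := by
  refine ⟨fun h => ?_, length_lt_simpleReflection_mul⟩
  by_contra hn
  exact h.not_gt <| length_simpleReflection_mul_lt <|
    (not_lt.1 hn).lt_of_ne (isRegularPoint_smul_basePoint b w _)

theorem length_simpleReflection_mul_ne (i : Node b) (w : affineWeylGroup P) :
    length b (simpleReflection b i * w) ≠ length b w := by
  rcases lt_or_gt_of_ne (isRegularPoint_smul_basePoint b w (wall b i)) with h | h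
  · exact (length_simpleReflection_mul_lt h).ne
  · exact (length_lt_simpleReflection_mul h).ne'

theorem simpleReflection_ne_one (i : Node b) : simpleReflection b i ≠ 1 := fun h =>
  length_simpleReflection_mul_ne i (1 : affineWeylGroup P) (by rw [h, mul_one])

/-- The folding condition: a wall that separates two adjacent alcoves contains their common
panel. -/
theorem simpleReflection_mul_eq_mul_simpleReflection {i j : Node b} {w : affineWeylGroup P}
    (h : length b w < length b (simpleReflection b i * w))
    (h' : length b (simpleReflection b i * (w * simpleReflection b j)) <
      length b (w * simpleReflection b j)) :
    simpleReflection b i * w = w * simpleReflection b j := by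
  rw [length_lt_simpleReflection_mul_iff] at h
  rw [length_simpleReflection_mul_lt_iff, mul_smul] at h'
  obtain ⟨g, hg, hgw⟩ := exists_affineEval_smul w (wall b i)
  rw [← hg] at h h'
  rw [eq_wall_of_separates h h', ← simpleReflection_eq_weylReflection,
    ← simpleReflection_eq_weylReflection] at hgw
  rw [hgw]
  group

/-- A wall that separates two alcoves is crossed by any minimal gallery between them. -/
theorem length_conj_simpleReflection_mul_lt {i : Node b} {v u : affineWeylGroup P}
    (h : length b (simpleReflection b i * v) < length b v)
    (h' : length b (v * u) < length b (simpleReflection b i * (v * u))) :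
    length b (v⁻¹ * simpleReflection b i * v * u) < length b u := by
  rw [length_simpleReflection_mul_lt_iff] at h
  rw [length_lt_simpleReflection_mul_iff, mul_smul] at h'
  obtain ⟨g, hg, hgv⟩ := exists_affineEval_smul v (wall b i)
  rw [simpleReflection_eq_weylReflection, ← hgv, ← weylReflection_oppositeRoot]
  refine length_weylReflection_mul_lt ⟨?_, ?_⟩ <;> rw [affineEval_oppositeRoot, hg] <;> linarith

theorem affineEval_smul_fundamentalVertex_nonpos {w : affineWeylGroup P} {f : ι × ℤ}
    (h : affineEval P f (w • basePoint b) < 0) (i : Node b) :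
    affineEval P f (w • fundamentalVertex b i) ≤ 0 := by
  obtain ⟨g, hg, -⟩ := exists_affineEval_smul w (oppositeRoot P f)
  simp only [affineEval_oppositeRoot] at hg
  have := affineEval_fundamentalVertex_nonneg (f := g) (basePoint_mem b) (by rw [hg]; linarith) i
  rw [hg] at this
  linarith

theorem affineEval_wall_fundamentalVertex_nonneg (k i : Node b) :
    0 ≤ affineEval P (wall b k) (fundamentalVertex b i) :=
  affineEval_fundamentalVertex_nonneg (basePoint_mem b) (affineEval_wall_basePoint_pos b k) i

variable (b) in
theorem fundamentalVertex_injective : Function.Injective (fundamentalVertex b) := by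
  intro i j h
  by_contra hne
  have hself := affineEval_wall_fundamentalVertex_self b i
  rw [h, affineEval_wall_fundamentalVertex_of_ne b hne] at hself
  exact (inv_pos.2 (mark_pos b i)).ne hself

/-- If `s_k w` is shorter than `w`, then the common vertex lies on the wall of `s_k`, so `s_k w`
maps it to itself as well. -/
theorem eq_of_smul_fundamentalVertex_eq {w : affineWeylGroup P} {i j : Node b}
    (h : w • fundamentalVertex b i = fundamentalVertex b j) : i = j := by
  induction hn : length b w using Nat.strong_induction_on generalizing w with
  | _ n ih =>
    by_cases hw : w = 1
    · rw [hw, one_smul] at h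
      exact fundamentalVertex_injective b h
    · obtain ⟨k, hk⟩ := exists_length_simpleReflection_mul_lt (b := b) hw
      have hnonpos := affineEval_smul_fundamentalVertex_nonpos
        (length_simpleReflection_mul_lt_iff.1 hk) i
      rw [h] at hnonpos
      have hzero := hnonpos.antisymm (affineEval_wall_fundamentalVertex_nonneg k j)
      refine ih _ (hn ▸ hk) (w := simpleReflection b k * w) ?_ rfl
      rw [mul_smul, h, simpleReflection_eq_weylReflection, weylReflection_smul, hzero, zero_smul,
        sub_zero]

theorem eq_of_smul_fundamentalVertex_eq_smul {v w : affineWeylGroup P} {i j : Node b}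
    (h : v • fundamentalVertex b i = w • fundamentalVertex b j) : i = j := by
  refine eq_of_smul_fundamentalVertex_eq (w := w⁻¹ * v) ?_
  rw [mul_smul, h, inv_smul_smul]

theorem ne_of_length_simpleReflection_mul_lt {w : affineWeylGroup P} {k j : Node b}
    (hk : length b (simpleReflection b k * w) < length b w)
    (h : w • fundamentalVertex b j = fundamentalVertex b j) : k ≠ j := by
  rintro rfl
  have hnonpos := affineEval_smul_fundamentalVertex_nonpos
    (length_simpleReflection_mul_lt_iff.1 hk) k
  rw [h, affineEval_wall_fundamentalVertex_self] at hnonpos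
  exact hnonpos.not_gt (inv_pos.2 (mark_pos b k))

/-- The pointwise stabiliser of the vertices of types in `S` is generated by the simple
reflections outside `S`. -/
theorem stabilizer_induction {p : affineWeylGroup P → Prop} {S : Set (Node b)} (one : p 1)
    (simpleReflection_mul : ∀ k ∉ S, ∀ w, p w → p (simpleReflection b k * w))
    {w : affineWeylGroup P} (h : ∀ j ∈ S, w • fundamentalVertex b j = fundamentalVertex b j) :
    p w := by
  induction hn : length b w using Nat.strong_induction_on generalizing w with
  | _ n ih =>
    by_cases hw : w = 1
    · rwa [hw]
    · obtain ⟨k, hk⟩ := exists_length_simpleReflection_mul_lt (b := b) hw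
      have hkS : k ∉ S := fun hkS => ne_of_length_simpleReflection_mul_lt hk (h k hkS) rfl
      have hfix : ∀ j ∈ S, (simpleReflection b k * w) • fundamentalVertex b j =
          fundamentalVertex b j := fun j hj => by
        rw [mul_smul, h j hj, simpleReflection_smul_fundamentalVertex]
        rintro rfl
        exact hkS hj
      have := simpleReflection_mul k hkS _ (ih _ (hn ▸ hk) hfix rfl)
      rwa [simpleReflection_mul_cancel_left] at this

theorem eq_one_or_eq_simpleReflection {w : affineWeylGroup P} {i : Node b}
    (h : ∀ j, j ≠ i → w • fundamentalVertex b j = fundamentalVertex b j) :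
    w = 1 ∨ w = simpleReflection b i := by
  refine stabilizer_induction (b := b) (p := fun w => w = 1 ∨ w = simpleReflection b i)
    (S := {i}ᶜ) (.inl rfl) (fun k hk w hw => ?_) h
  obtain rfl : k = i := not_not.1 hk
  rcases hw with rfl | rfl
  · exact .inr (mul_one _)
  · exact .inl (simpleReflection_mul_self b k)

end Length

/-! ### Distances with values in the affine Weyl group -/

section WeylDistance

variable {ι M N : Type*} [AddCommGroup M] [Module ℝ M] [AddCommGroup N] [Module ℝ N]
  {P : RootPairing ι ℝ M N} {C : Type*}

/-- Graphs of partially defined isometries from the affine Weyl group. -/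
def IsIsometricGraph (δ : C → C → affineWeylGroup P) (G : Set (affineWeylGroup P × C)) : Prop :=
  ∀ p ∈ G, ∀ q ∈ G, δ p.2 q.2 = p.1⁻¹ * q.1

/-- Isometries from the affine Weyl group, with its Weyl distance `v⁻¹ * w`; their images are
the apartments. -/
def IsIsometry (δ : C → C → affineWeylGroup P) (φ : affineWeylGroup P → C) : Prop :=
  ∀ v w, δ (φ v) (φ w) = v⁻¹ * w

/-- `w` is the retraction of the chamber `c` onto the apartment `base`, centred at the filter `F`:
some apartment through `c` agrees with `base` eventually along `F`. -/
def RetractsAlong (δ : C → C → affineWeylGroup P) (F : Filter (affineWeylGroup P))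
    (base : affineWeylGroup P → C) (c : C) (w : affineWeylGroup P) : Prop :=
  ∃ φ, IsIsometry δ φ ∧ φ w = c ∧ ∀ᶠ y in F, φ y = base y

variable {δ : C → C → affineWeylGroup P} {F : Filter (affineWeylGroup P)}
  {base : affineWeylGroup P → C} {c : C}

theorem RetractsAlong.unique [F.NeBot] {v w : affineWeylGroup P}
    (hv : RetractsAlong δ F base c v) (hw : RetractsAlong δ F base c w) : v = w := by
  obtain ⟨φ, hφ, rfl, hφF⟩ := hv
  obtain ⟨ψ, hψ, hψw, hψF⟩ := hw
  obtain ⟨y, hφy, hψy⟩ := (hφF.and hψF).exists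
  have := hφ y v
  rw [hφy, ← hψw, ← hψy, hψ] at this
  exact (mul_left_cancel this).symm

variable [P.IsRootSystem] [Nonempty ι] {b : P.Base}

variable (b) in
/-- The axioms of a `W`-metric space in which panels are nondegenerate: `δ c d` is the Weyl
distance between the chambers `c` and `d`, and `δ c d = s_i` means that they are distinct and
`i`-adjacent. -/
structure IsWeylDistance (δ : C → C → affineWeylGroup P) : Prop where
  eq_one_iff : ∀ c d, δ c d = 1 ↔ c = d
  inv : ∀ c d, (δ c d)⁻¹ = δ d c
  step : ∀ {c d d' i}, δ d d' = simpleReflection b i →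
    δ c d' = δ c d * simpleReflection b i ∨ δ c d' = δ c d
  exists_step : ∀ c d i, ∃ d', δ d d' = simpleReflection b i ∧
    δ c d' = δ c d * simpleReflection b i

/-- `y` lies on the same side as `x` of the wall that separates `x` from `x s_i`. -/
def SameSide (i : Node b) (x y : affineWeylGroup P) : Prop :=
  length b (x⁻¹ * y) < length b (simpleReflection b i * (x⁻¹ * y))

namespace IsWeylDistance

variable (h : IsWeylDistance b δ)

include h

theorem self (c : C) : δ c c = 1 := (h.eq_one_iff c c).2 rfl

theorem symm_simple {c d : C} {i : Node b} (hcd : δ c d = simpleReflection b i) :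
    δ d c = simpleReflection b i := by
  rw [← h.inv, hcd, simpleReflection_inv]

theorem step_left {c d e : C} {i : Node b} (hcd : δ c d = simpleReflection b i) :
    δ d e = simpleReflection b i * δ c e ∨ δ d e = δ c e := by
  rw [← h.inv, ← h.inv e c]
  exact (h.step hcd).imp (fun he => by rw [he, mul_inv_rev, simpleReflection_inv])
    (fun he => by rw [he])

theorem exists_step_left (c e : C) (i : Node b) : ∃ d, δ c d = simpleReflection b i ∧
    δ d e = simpleReflection b i * δ c e := by
  obtain ⟨d, hcd, hed⟩ := h.exists_step e c i
  exact ⟨d, hcd, by rw [← h.inv, hed, mul_inv_rev, simpleReflection_inv, h.inv]⟩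

end IsWeylDistance

variable [Finite ι] [P.IsCrystallographic] [P.IsReduced] [P.IsIrreducible]

theorem length_mul_simpleReflection (w : affineWeylGroup P) (i : Node b) :
    length b (w * simpleReflection b i) = length b (simpleReflection b i * w⁻¹) := by
  rw [← length_inv, mul_inv_rev, simpleReflection_inv]

theorem length_mul_simpleReflection_le (w : affineWeylGroup P) (i : Node b) :
    length b (w * simpleReflection b i) ≤ length b w + 1 := by
  rw [length_mul_simpleReflection, ← length_inv w]
  exact length_simpleReflection_mul_le _ _

theorem exists_length_mul_simpleReflection_lt {w : affineWeylGroup P} (h : w ≠ 1) :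
    ∃ i, length b (w * simpleReflection b i) < length b w := by
  obtain ⟨i, hi⟩ := exists_length_simpleReflection_mul_lt (b := b) (inv_ne_one.2 h)
  exact ⟨i, by rwa [length_mul_simpleReflection, ← length_inv w]⟩

theorem simpleReflection_induction {p : affineWeylGroup P → Prop} (one : p 1)
    (mul_simpleReflection : ∀ w (i : Node b), p w → p (w * simpleReflection b i))
    (w : affineWeylGroup P) : p w := by
  induction hn : length b w using Nat.strong_induction_on generalizing w with
  | _ n ih =>
    by_cases hw : w = 1
    · rwa [hw]
    · obtain ⟨i, hi⟩ := exists_length_mul_simpleReflection_lt (b := b) hw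
      have := mul_simpleReflection _ i (ih _ (hn ▸ hi) _ rfl)
      rwa [simpleReflection_mul_cancel_right] at this

/-- A half-apartment is convex: if `v` and `v u s_t` lie beyond the wall of `s_i`, then so does
every gallery of minimal length between them. -/
theorem length_simpleReflection_mul_lt_of_convex {i t : Node b} {v u : affineWeylGroup P}
    (hv : length b (simpleReflection b i * v) < length b v)
    (hvut : length b (simpleReflection b i * (v * u * simpleReflection b t)) <
      length b (v * u * simpleReflection b t))
    (hu : length b u < length b (u * simpleReflection b t)) :
    length b (simpleReflection b i * (v * u)) < length b (v * u) := by
  by_contra hn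
  have hvu := (not_lt.1 hn).lt_of_ne (length_simpleReflection_mul_ne i _).symm
  have hfold := simpleReflection_mul_eq_mul_simpleReflection hvu hvut
  have hlt := length_conj_simpleReflection_mul_lt hv hvu
  rw [mul_assoc, mul_assoc, hfold, mul_assoc v, inv_mul_cancel_left] at hlt
  exact hlt.not_gt hu

theorem sameSide_mul_simpleReflection_iff {i : Node b} {x y : affineWeylGroup P} :
    SameSide i (x * simpleReflection b i) y ↔ ¬ SameSide i x y := by
  have := length_simpleReflection_mul_ne i (x⁻¹ * y)
  rw [SameSide, SameSide, mul_inv_rev, simpleReflection_inv, mul_assoc,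
    simpleReflection_mul_cancel_left]
  omega

namespace IsWeylDistance

variable (h : IsWeylDistance b δ)

include h

theorem dist_of_length_lt {c d d' : C} {i : Node b} (hd : δ d d' = simpleReflection b i)
    (hlt : length b (δ c d) < length b (δ c d * simpleReflection b i)) :
    δ c d' = δ c d * simpleReflection b i := by
  induction hn : length b (δ c d) using Nat.strong_induction_on generalizing c with
  | _ n ih =>
    by_cases hw : δ c d = 1
    · rw [hw, (h.eq_one_iff c d).1 hw, hd, one_mul]
    · obtain ⟨t, ht⟩ := exists_length_simpleReflection_mul_lt (b := b) hw
      obtain ⟨c', hcc', hc'd⟩ := h.exists_step_left c d t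
      have hlt' : length b (δ c' d) < length b (δ c' d * simpleReflection b i) := by
        have := length_simpleReflection_mul_le t (δ c' d * simpleReflection b i)
        rw [hc'd, mul_assoc, simpleReflection_mul_cancel_left] at this
        rw [hc'd, mul_assoc]
        omega
      have hc'd' : δ c' d' = simpleReflection b t * (δ c d * simpleReflection b i) := by
        rw [ih _ (by rw [hc'd, ← hn]; exact ht) hlt' rfl, hc'd, mul_assoc]
      rcases h.step (c := c) hd with hcd' | hcd'
      · exact hcd'
      exfalso
      rcases h.step_left (e := d') (h.symm_simple hcc') with hstep | hstep <;>
        rw [hc'd', hcd'] at hstep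
      · rw [simpleReflection_mul_cancel_left] at hstep
        exact hlt.ne (congrArg _ hstep)
      · have hfold : simpleReflection b t * δ c d = δ c d * simpleReflection b i := by
          conv_lhs => rw [hstep, simpleReflection_mul_cancel_left]
        exact ht.not_gt (hfold ▸ hlt)

theorem dist_left_of_length_lt {c d e : C} {i : Node b} (hcd : δ c d = simpleReflection b i)
    (hlt : length b (δ c e) < length b (simpleReflection b i * δ c e)) :
    δ d e = simpleReflection b i * δ c e := by
  rw [← h.inv, h.dist_of_length_lt (c := e) hcd (by
    rwa [length_mul_simpleReflection, h.inv, ← h.inv c, length_inv]), mul_inv_rev,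
    simpleReflection_inv, h.inv]

theorem length_inv_mul_dist_le (c d e : C) :
    length b ((δ c d)⁻¹ * δ c e) ≤ length b (δ d e) := by
  induction hn : length b (δ d e) using Nat.strong_induction_on generalizing e with
  | _ n ih =>
    by_cases hw : δ d e = 1
    · rw [(h.eq_one_iff d e).1 hw, inv_mul_cancel, length_one]
      exact Nat.zero_le _
    · obtain ⟨t, ht⟩ := exists_length_mul_simpleReflection_lt (b := b) hw
      obtain ⟨e', hee', hde'⟩ := h.exists_step d e t
      have hle := ih _ (by rw [hde', ← hn]; exact ht) e' rfl
      rw [hde'] at hle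
      rcases h.step (c := c) (h.symm_simple hee') with hce | hce
      · have := length_mul_simpleReflection_le ((δ c d)⁻¹ * δ c e') t
        rw [hce, ← mul_assoc]
        omega
      · rw [hce]
        omega

theorem dist_eq_of_adjacent {c d e e' : C} {i t : Node b} (hcd : δ c d = simpleReflection b i)
    (he'e : δ e' e = simpleReflection b t) (hce' : δ c e' = δ c e * simpleReflection b t)
    (hlt : length b (simpleReflection b i * δ c e) < length b (δ c e))
    (hlt' : length b (simpleReflection b i * δ c e') < length b (δ c e'))
    (hde' : δ d e' = simpleReflection b i * δ c e') : δ d e = simpleReflection b i * δ c e := by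
  rcases h.step (c := d) he'e with hde | hde
  · rw [hde, hde', hce', mul_assoc, simpleReflection_mul_cancel_right]
  exfalso
  rw [hde', hce'] at hde
  rcases h.step_left (e := e) (h.symm_simple hcd) with hce | hce
  · rw [hde, simpleReflection_mul_cancel_left] at hce
    exact simpleReflection_ne_one t (mul_eq_left.1 hce.symm)
  · have hfold : simpleReflection b i * δ c e = δ c e * simpleReflection b t := by
      conv_lhs => rw [hce, hde, simpleReflection_mul_cancel_left]
    rw [hce', ← hfold, simpleReflection_mul_cancel_left] at hlt'
    exact hlt.not_gt hlt'

/-- The chambers of an apartment beyond a wall all have the same projection to a panel in that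
wall; this propagates along minimal galleries from `e₀`. -/
theorem dist_eq_of_dist_eq {c d e₀ e : C} {i : Node b} (hcd : δ c d = simpleReflection b i)
    (hlt₀ : length b (simpleReflection b i * δ c e₀) < length b (δ c e₀))
    (hde₀ : δ d e₀ = simpleReflection b i * δ c e₀)
    (hlt : length b (simpleReflection b i * δ c e) < length b (δ c e))
    (hce : δ c e = δ c e₀ * δ e₀ e) : δ d e = simpleReflection b i * δ c e := by
  induction hn : length b (δ e₀ e) using Nat.strong_induction_on generalizing e with
  | _ n ih =>
    by_cases hw : δ e₀ e = 1
    · rwa [← (h.eq_one_iff e₀ e).1 hw]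
    · obtain ⟨t, ht⟩ := exists_length_mul_simpleReflection_lt (b := b) hw
      obtain ⟨e', hee', he₀e'⟩ := h.exists_step e₀ e t
      have hlt_e' : length b (δ e₀ e') < length b (δ e₀ e) := by rwa [he₀e']
      have hce' : δ c e' = δ c e * simpleReflection b t := by
        rcases h.step (c := c) hee' with hstep | hstep
        · exact hstep
        · have := h.length_inv_mul_dist_le c e₀ e'
          rw [hstep, hce, inv_mul_cancel_left] at this
          exact absurd hlt_e' this.not_gt
      have hprod : δ c e' = δ c e₀ * δ e₀ e' := by rw [hce', he₀e', hce, mul_assoc]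
      have hlt' : length b (simpleReflection b i * δ c e') < length b (δ c e') := by
        rw [hprod]
        refine length_simpleReflection_mul_lt_of_convex (t := t) hlt₀ ?_ ?_
        · rwa [← hprod, hce', simpleReflection_mul_cancel_right]
        · rwa [he₀e', simpleReflection_mul_cancel_right]
      exact h.dist_eq_of_adjacent hcd (h.symm_simple hee') hce' hlt hlt'
        (ih _ (hn ▸ hlt_e') hlt' hprod rfl)

/-- If `G` meets the far side of the wall between `x` and `x s_i`, its chambers there determine
the chamber to be added; otherwise any chamber `i`-adjacent to `c` will do. -/
theorem exists_insert_isIsometricGraph {G : Set (affineWeylGroup P × C)}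
    (hG : IsIsometricGraph δ G) {x : affineWeylGroup P} {c : C} (hxc : (x, c) ∈ G) (i : Node b) :
    ∃ d, IsIsometricGraph δ (insert (x * simpleReflection b i, d) G) := by
  suffices ∃ d, ∀ p ∈ G, δ d p.2 = simpleReflection b i * δ c p.2 by
    obtain ⟨d, hd⟩ := this
    have hdG : ∀ p ∈ G, δ d p.2 = (x * simpleReflection b i)⁻¹ * p.1 := fun p hp => by
      rw [hd p hp, hG _ hxc _ hp, mul_inv_rev, simpleReflection_inv, mul_assoc]
    refine ⟨d, ?_⟩
    rintro p (rfl | hp) q (rfl | hq)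
    · rw [h.self, inv_mul_cancel]
    · exact hdG q hq
    · rw [← h.inv, hdG p hp]
      group
    · exact hG p hp q hq
  by_cases hex : ∃ p ∈ G, length b (simpleReflection b i * δ c p.2) < length b (δ c p.2)
  · obtain ⟨p, hp, hlt⟩ := hex
    obtain ⟨d, hcd, hdp⟩ := h.exists_step_left c p.2 i
    refine ⟨d, fun q hq => ?_⟩
    rcases lt_or_gt_of_ne (length_simpleReflection_mul_ne i (δ c q.2)) with hq' | hq'
    · refine h.dist_eq_of_dist_eq hcd hlt hdp hq' ?_
      rw [hG _ hxc _ hq, hG _ hxc _ hp, hG _ hp _ hq]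
      group
    · exact h.dist_left_of_length_lt hcd hq'
  · obtain ⟨d, hcd, -⟩ := h.exists_step c c i
    refine ⟨d, fun q hq => h.dist_left_of_length_lt hcd ?_⟩
    exact (not_lt.1 fun hlt => hex ⟨q, hq, hlt⟩).lt_of_ne (length_simpleReflection_mul_ne i _).symm

theorem exists_isIsometry_of_isIsometricGraph {G : Set (affineWeylGroup P × C)}
    (hG : IsIsometricGraph δ G) (hne : G.Nonempty) :
    ∃ φ, IsIsometry δ φ ∧ ∀ p ∈ G, φ p.1 = p.2 := by
  obtain ⟨H, hGH, hH⟩ := zorn_subset_nonempty {H | IsIsometricGraph δ H}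
    (fun S hS hchain _ => ⟨⋃₀ S, by
      rintro p ⟨s, hs, hps⟩ q ⟨t, ht, hqt⟩
      rcases hchain.total hs ht with hst | hts
      · exact hS ht p (hst hps) q hqt
      · exact hS hs p hps q (hts hqt), fun s hs => Set.subset_sUnion_of_mem hs⟩) G hG
  have hiso : IsIsometricGraph δ H := hH.prop
  have htotal : ∀ w : affineWeylGroup P, ∃ c, (w, c) ∈ H := by
    obtain ⟨⟨x, c⟩, hxc⟩ := hne
    suffices ∀ w : affineWeylGroup P, ∃ c, (x * w, c) ∈ H from fun w => by
      simpa using this (x⁻¹ * w)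
    refine simpleReflection_induction (b := b) ⟨c, by rw [mul_one]; exact hGH hxc⟩ ?_
    rintro w i ⟨c, hc⟩
    obtain ⟨d, hd⟩ := h.exists_insert_isIsometricGraph hiso hc i
    refine ⟨d, ?_⟩
    rw [← mul_assoc]
    exact hH.le_of_ge hd (Set.subset_insert _ _) (Set.mem_insert _ _)
  choose φ hφ using htotal
  refine ⟨φ, fun v w => hiso _ (hφ v) _ (hφ w), fun p hp => ?_⟩
  have := hiso _ (hφ p.1) _ (hGH hp)
  rw [inv_mul_cancel] at this
  exact (h.eq_one_iff _ _).1 this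

end IsWeylDistance

theorem RetractsAlong.mul_simpleReflection_of_sameSide (h : IsWeylDistance b δ)
    {x : affineWeylGroup P} {d : C} {i : Node b} (hx : RetractsAlong δ F base c x)
    (hside : ∀ᶠ y in F, SameSide i x y) (hcd : δ c d = simpleReflection b i) :
    RetractsAlong δ F base d (x * simpleReflection b i) := by
  obtain ⟨φ, hφ, rfl, hφF⟩ := hx
  have hd : ∀ y, SameSide i x y → δ d (φ y) = (x * simpleReflection b i)⁻¹ * y := by
    intro y hy
    rw [h.dist_left_of_length_lt hcd (by rw [hφ]; exact hy), hφ, mul_inv_rev,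
      simpleReflection_inv, mul_assoc]
  have hG : IsIsometricGraph δ
      (insert (x * simpleReflection b i, d) ((fun y => (y, φ y)) '' {y | SameSide i x y})) := by
    rintro p (rfl | ⟨y, hy, rfl⟩) q (rfl | ⟨z, hz, rfl⟩)
    · rw [h.self, inv_mul_cancel]
    · exact hd z hz
    · rw [← h.inv, hd y hy]
      group
    · exact hφ y z
  obtain ⟨ψ, hψ, hψG⟩ := h.exists_isIsometry_of_isIsometricGraph hG ⟨_, Set.mem_insert _ _⟩
  refine ⟨ψ, hψ, hψG _ (Set.mem_insert _ _), ?_⟩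
  filter_upwards [hside, hφF] with y hy hφy
  rw [← hφy]
  exact hψG _ (Set.mem_insert_of_mem _ ⟨y, hy, rfl⟩)

theorem RetractsAlong.exists_of_not_sameSide (h : IsWeylDistance b δ) {x : affineWeylGroup P}
    {i : Node b} (hx : RetractsAlong δ F base c x) (hside : ∀ᶠ y in F, ¬ SameSide i x y) :
    ∃ c', δ c c' = simpleReflection b i ∧
      RetractsAlong δ F base c' (x * simpleReflection b i) ∧
      ∀ d, δ c d = simpleReflection b i → d ≠ c' → RetractsAlong δ F base d x := by
  obtain ⟨φ, hφ, rfl, hφF⟩ := id hx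
  have hadj : δ (φ x) (φ (x * simpleReflection b i)) = simpleReflection b i := by
    rw [hφ, inv_mul_cancel_left]
  have hx' : RetractsAlong δ F base (φ (x * simpleReflection b i)) (x * simpleReflection b i) :=
    ⟨φ, hφ, rfl, hφF⟩
  refine ⟨φ (x * simpleReflection b i), hadj, hx', fun d hd hne => ?_⟩
  have hd' : δ (φ (x * simpleReflection b i)) d = simpleReflection b i := by
    rcases h.step_left (e := d) hadj with hstep | hstep
    · rw [hd, simpleReflection_mul_self, h.eq_one_iff] at hstep
      exact absurd hstep.symm hne
    · rw [hstep, hd]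
  have := hx'.mul_simpleReflection_of_sameSide h
    (hside.mono fun _ => sameSide_mul_simpleReflection_iff.2) hd'
  rwa [simpleReflection_mul_cancel_right] at this

theorem exists_retractsAlong (h : IsWeylDistance b δ) (hbase : IsIsometry δ base)
    (hF : ∀ (x : affineWeylGroup P) (i : Node b),
      (∀ᶠ y in F, SameSide i x y) ∨ ∀ᶠ y in F, ¬ SameSide i x y) (c : C) :
    ∃ x, RetractsAlong δ F base c x := by
  suffices ∀ w c, δ (base 1) c = w → ∃ x, RetractsAlong δ F base c x from this _ c rfl
  refine simpleReflection_induction (b := b) ?_ ?_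
  · intro c hc
    exact ⟨1, base, hbase, (h.eq_one_iff _ _).1 hc, .of_forall fun _ => rfl⟩
  · intro w i ih c hc
    obtain ⟨c', hcc', hc'⟩ := h.exists_step (base 1) c i
    rw [hc, simpleReflection_mul_cancel_right] at hc'
    obtain ⟨x, hx⟩ := ih c' hc'
    have hc'c := h.symm_simple hcc'
    rcases hF x i with hside | hside
    · exact ⟨_, hx.mul_simpleReflection_of_sameSide h hside hc'c⟩
    · obtain ⟨c'', -, hc'', hother⟩ := hx.exists_of_not_sameSide h hside
      by_cases hcc'' : c = c''
      · exact ⟨_, hcc'' ▸ hc''⟩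
      · exact ⟨_, hother c hc'c hcc''⟩

end WeylDistance

/-! ### Charts of apartments -/

section SimplicialComplexes

variable {V V' V'' : Type*} {K : PreAbstractSimplicialComplex V} {s t : Finset V} {x : V}

theorem mem_of_subset (hs : s ∈ K) (hts : t ⊆ s) (ht : t.Nonempty) : t ∈ K :=
  (K.isRelLowerSet_faces hs).2 hts ht

theorem nonempty_of_mem (hs : s ∈ K) : s.Nonempty := (K.isRelLowerSet_faces hs).1

theorem mem_vertices_of_mem (hs : s ∈ K) (hx : x ∈ s) : x ∈ vertices K :=
  mem_of_subset hs (Finset.singleton_subset_iff.2 hx) (Finset.singleton_nonempty x)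

theorem mem_vertices_inf {L : PreAbstractSimplicialComplex V} (hs : s ∈ K) (ht : t ∈ L)
    (hxs : x ∈ s) (hxt : x ∈ t) : x ∈ vertices (K ⊓ L) :=
  ⟨mem_vertices_of_mem hs hxs, mem_vertices_of_mem ht hxt⟩

theorem IsSimplicialIso.comp {L : PreAbstractSimplicialComplex V'}
    {L' : PreAbstractSimplicialComplex V''} {f : V → V'} {g : V' → V''}
    (hg : IsSimplicialIso L L' g) (hf : IsSimplicialIso K L f) :
    IsSimplicialIso K L' (g ∘ f) := by
  classical
  refine ⟨hg.1.comp hf.1, fun s hs => ?_⟩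
  rw [hf.2 s hs, hg.2, Finset.image_image]
  rw [Finset.coe_image]
  exact hf.1.mapsTo.mono_left hs |>.image_subset

end SimplicialComplexes

section Charts

variable {ι M N : Type*} [AddCommGroup M] [Module ℝ M] [AddCommGroup N] [Module ℝ N]
  {P : RootPairing ι ℝ M N} [P.IsRootSystem] [Nonempty ι] {V : Type*}

/-- The vertex of type `i` of the alcove `w`. -/
def alcoveVertex (b : P.Base) (w : affineWeylGroup P) (i : Node b) : N :=
  w • fundamentalVertex b i

open Classical in
/-- The image under the vertex map `F` of the simplex that corresponds to the alcove `w`. -/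
def cell (b : P.Base) (F : N → V) (w : affineWeylGroup P) : Finset V :=
  (alcoveVertices b w).image F

/-- `F` identifies the Coxeter complex with the complex `A`; this is `IsSimplicialIso` in terms
of the vertices of alcoves. -/
structure IsChart (b : P.Base) (A : PreAbstractSimplicialComplex V) (F : N → V) : Prop where
  inj : ∀ {v i w j}, F (alcoveVertex b v i) = F (alcoveVertex b w j) →
    alcoveVertex b v i = alcoveVertex b w j
  mem_iff : ∀ s, s ∈ A ↔ s.Nonempty ∧ ∃ w, s ⊆ cell b F w

variable {b : P.Base} {F F' : N → V} {A : PreAbstractSimplicialComplex V}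
  {u v w : affineWeylGroup P} {i j : Node b}

theorem mem_alcoveVertices {x : N} : x ∈ alcoveVertices b w ↔ ∃ i, alcoveVertex b w i = x := by
  simp only [alcoveVertices, Finset.mem_image, Finset.mem_univ, true_and]
  rfl

theorem alcoveVertex_mul (v w : affineWeylGroup P) (i : Node b) :
    alcoveVertex b (v * w) i = v • alcoveVertex b w i := mul_smul v w _

theorem alcoveVertex_mem_vertices (w : affineWeylGroup P) (i : Node b) :
    alcoveVertex b w i ∈ vertices (coxeterComplex b) :=
  ⟨Finset.singleton_nonempty _, w, Finset.singleton_subset_iff.2 (mem_alcoveVertices.2 ⟨i, rfl⟩)⟩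

theorem exists_alcoveVertex_eq {x : N} (hx : x ∈ vertices (coxeterComplex b)) :
    ∃ w i, alcoveVertex b w i = x := by
  obtain ⟨-, w, hw⟩ := hx
  exact ⟨w, mem_alcoveVertices.1 (hw (Finset.mem_singleton_self x))⟩

theorem mem_cell {x : V} : x ∈ cell b F w ↔ ∃ i, F (alcoveVertex b w i) = x := by
  classical
  simp only [cell, Finset.mem_image, mem_alcoveVertices, exists_exists_eq_and]

theorem alcoveVertex_mem_cell (F : N → V) (w : affineWeylGroup P) (i : Node b) :
    F (alcoveVertex b w i) ∈ cell b F w := mem_cell.2 ⟨i, rfl⟩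

theorem cell_nonempty (F : N → V) (w : affineWeylGroup P) : (cell b F w).Nonempty :=
  ⟨_, alcoveVertex_mem_cell F w none⟩

theorem cell_congr (h : ∀ i, F (alcoveVertex b v i) = F' (alcoveVertex b w i)) :
    cell b F v = cell b F' w := by
  ext x
  simp only [mem_cell, h]

theorem image_cell_eq [DecidableEq V] {f : V → V}
    (h : ∀ i, f (F (alcoveVertex b w i)) = F' (alcoveVertex b w i)) :
    (cell b F w).image f = cell b F' w := by
  ext x
  simp only [Finset.mem_image, mem_cell, exists_exists_eq_and, h]

theorem cell_comp_smul (F : N → V) (u w : affineWeylGroup P) :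
    cell b (fun x => F (u • x)) w = cell b F (u * w) :=
  cell_congr fun _ => congrArg F (alcoveVertex_mul _ _ _).symm

theorem IsChart.cell_mem (h : IsChart b A F) (w : affineWeylGroup P) : cell b F w ∈ A :=
  (h.mem_iff _).2 ⟨cell_nonempty F w, w, Finset.Subset.refl _⟩

theorem IsChart.isSimplicialIso (h : IsChart b A F) :
    IsSimplicialIso (coxeterComplex b) A F := by
  classical
  refine ⟨⟨fun x hx => ?_, fun x hx y hy hxy => ?_, fun x hx => ?_⟩, fun s hs => ?_⟩
  · obtain ⟨w, i, rfl⟩ := exists_alcoveVertex_eq hx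
    exact mem_vertices_of_mem (h.cell_mem w) (alcoveVertex_mem_cell F w i)
  · obtain ⟨v, i, rfl⟩ := exists_alcoveVertex_eq hx
    obtain ⟨w, j, rfl⟩ := exists_alcoveVertex_eq hy
    exact h.inj hxy
  · obtain ⟨-, w, hw⟩ := (h.mem_iff _).1 hx
    obtain ⟨i, hi⟩ := mem_cell.1 (hw (Finset.mem_singleton_self x))
    exact ⟨_, alcoveVertex_mem_vertices w i, hi⟩
  · rw [h.mem_iff, Finset.image_nonempty]
    refine and_congr_right fun _ => exists_congr fun w => ⟨Finset.image_subset_image, ?_⟩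
    intro hw y hy
    obtain ⟨i, hi⟩ := mem_cell.1 (hw (Finset.mem_image_of_mem F hy))
    obtain ⟨v, j, rfl⟩ := exists_alcoveVertex_eq (hs hy)
    exact mem_alcoveVertices.2 ⟨i, h.inj hi⟩

theorem IsSimplicialIso.isChart (h : IsSimplicialIso (coxeterComplex b) A F) :
    IsChart b A F := by
  classical
  have hcell : ∀ w, cell b F w ∈ A := fun w =>
    (h.2 (alcoveVertices b w) fun x hx => by
      obtain ⟨i, rfl⟩ := mem_alcoveVertices.1 hx
      exact alcoveVertex_mem_vertices w i).1
    ⟨⟨_, mem_alcoveVertices.2 ⟨none, rfl⟩⟩, w, Finset.Subset.refl _⟩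
  refine ⟨fun hvw => h.1.injOn (alcoveVertex_mem_vertices _ _) (alcoveVertex_mem_vertices _ _) hvw,
    fun s => ⟨fun hs => ⟨nonempty_of_mem hs, ?_⟩, fun ⟨hs, w, hw⟩ => mem_of_subset (hcell w) hw hs⟩⟩
  obtain ⟨t, ht, rfl⟩ := Finset.subset_set_image_iff.1
    (show (s : Set V) ⊆ F '' vertices (coxeterComplex b) from
      h.1.image_eq ▸ fun x hx => mem_vertices_of_mem hs hx)
  obtain ⟨-, w, hw⟩ := (h.2 t ht).2 hs
  exact ⟨w, Finset.image_subset_image hw⟩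

theorem IsChart.comp {A' : PreAbstractSimplicialComplex V} {g : V → V}
    (hg : IsSimplicialIso A' A g) (h : IsChart b A' F) : IsChart b A (g ∘ F) :=
  (hg.comp h.isSimplicialIso).isChart

theorem IsChart.comp_smul (h : IsChart b A F) (u : affineWeylGroup P) :
    IsChart b A fun x => F (u • x) where
  inj {v i w j} hvw := by
    simp only [← alcoveVertex_mul] at hvw
    have := h.inj hvw
    rwa [alcoveVertex_mul, alcoveVertex_mul, smul_left_cancel_iff] at this
  mem_iff s := by
    rw [h.mem_iff]
    refine and_congr_right fun _ => ⟨?_, ?_⟩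
    · rintro ⟨w, hw⟩
      exact ⟨u⁻¹ * w, by rwa [cell_comp_smul, mul_inv_cancel_left]⟩
    · rintro ⟨w, hw⟩
      exact ⟨u * w, by rwa [← cell_comp_smul]⟩

variable [Finite ι] [P.IsCrystallographic] [P.IsReduced] [P.IsIrreducible]

theorem type_eq_of_alcoveVertex_eq (h : alcoveVertex b v i = alcoveVertex b w j) : i = j :=
  eq_of_smul_fundamentalVertex_eq_smul h

theorem alcoveVertex_mul_simpleReflection (w : affineWeylGroup P) (h : i ≠ j) :
    alcoveVertex b (w * simpleReflection b j) i = alcoveVertex b w i := by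
  rw [alcoveVertex_mul, alcoveVertex, simpleReflection_smul_fundamentalVertex h.symm, alcoveVertex]

theorem eq_or_eq_mul_simpleReflection (h : ∀ j, j ≠ i → alcoveVertex b w j = alcoveVertex b v j) :
    w = v ∨ w = v * simpleReflection b i := by
  have hfix : ∀ j, j ≠ i → (v⁻¹ * w) • fundamentalVertex b j = fundamentalVertex b j :=
    fun j hj => by rw [mul_smul, inv_smul_eq_iff]; exact h j hj
  exact (eq_one_or_eq_simpleReflection hfix).imp (fun h => (inv_mul_eq_one.1 h).symm)
    inv_mul_eq_iff_eq_mul.1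

theorem eq_of_alcoveVertex_eq (h : ∀ j : Node b, alcoveVertex b w j = alcoveVertex b v j) :
    w = v := by
  have hfix : v⁻¹ * w = 1 := stabilizer_induction (b := b) (p := fun u => u = 1) (S := Set.univ)
    rfl (fun k hk => absurd (Set.mem_univ k) hk) fun j _ => by
      rw [mul_smul, inv_smul_eq_iff]
      exact h j
  exact (inv_mul_eq_one.1 hfix).symm

theorem alcoveVertex_mul_simpleReflection_self_ne (w : affineWeylGroup P) (i : Node b) :
    alcoveVertex b (w * simpleReflection b i) i ≠ alcoveVertex b w i := by
  intro h
  have : w * simpleReflection b i = w := eq_of_alcoveVertex_eq (b := b) fun j => by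
    by_cases hj : j = i
    · rw [hj, h]
    · exact alcoveVertex_mul_simpleReflection w hj
  exact simpleReflection_ne_one i (mul_eq_left.1 this)

namespace IsChart

variable (h : IsChart b A F)

include h

theorem type_eq (hvw : F (alcoveVertex b v i) = F (alcoveVertex b w j)) : i = j :=
  type_eq_of_alcoveVertex_eq (h.inj hvw)

theorem card_cell (w : affineWeylGroup P) : (cell b F w).card = Fintype.card (Node b) := by
  classical
  have : cell b F w = Finset.univ.image fun i => F (alcoveVertex b w i) := by
    ext x
    simp only [mem_cell, Finset.mem_image, Finset.mem_univ, true_and]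
  rw [this, Finset.card_image_of_injective _ fun i j hij => h.type_eq hij, Finset.card_univ]

theorem mem_cell_iff :
    F (alcoveVertex b v i) ∈ cell b F w ↔ alcoveVertex b v i = alcoveVertex b w i := by
  refine ⟨fun hm => ?_, fun hvw => hvw ▸ alcoveVertex_mem_cell F w i⟩
  obtain ⟨j, hj⟩ := mem_cell.1 hm
  obtain rfl := h.type_eq hj
  exact (h.inj hj).symm

theorem cell_injective : Function.Injective (cell b F) := fun v _ hvw =>
  eq_of_alcoveVertex_eq (b := b) fun i => h.mem_cell_iff.1 (hvw ▸ alcoveVertex_mem_cell F v i)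

/-- A panel of `A` lies in only two cells, so agreement propagates to adjacent alcoves. -/
theorem eq_on_mul_simpleReflection (h' : IsChart b A F')
    (hu : ∀ j, F (alcoveVertex b u j) = F' (alcoveVertex b u j)) (i j : Node b) :
    F (alcoveVertex b (u * simpleReflection b i) j) =
      F' (alcoveVertex b (u * simpleReflection b i) j) := by
  by_cases hij : j = i
  swap
  · rw [alcoveVertex_mul_simpleReflection u hij, hu]
  subst hij
  obtain ⟨-, w, hw⟩ := (h'.mem_iff _).1 (h.cell_mem (u * simpleReflection b j))
  have hpanel : ∀ k, k ≠ j → alcoveVertex b w k = alcoveVertex b u k := fun k hk => by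
    have := hw (alcoveVertex_mem_cell F (u * simpleReflection b j) k)
    rw [alcoveVertex_mul_simpleReflection u hk, hu, h'.mem_cell_iff] at this
    exact this.symm
  obtain ⟨k, hk⟩ := mem_cell.1 (hw (alcoveVertex_mem_cell F (u * simpleReflection b j) j))
  have hkj : k = j := by
    by_contra hkj
    rw [hpanel k hkj, ← hu] at hk
    exact hkj (h.type_eq hk)
  subst hkj
  rcases eq_or_eq_mul_simpleReflection hpanel with rfl | rfl
  · rw [← hu] at hk
    exact absurd (h.inj hk).symm (alcoveVertex_mul_simpleReflection_self_ne _ _)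
  · exact hk.symm

theorem eq_of_eq_on_alcove (h' : IsChart b A F')
    (hu : ∀ i, F (alcoveVertex b u i) = F' (alcoveVertex b u i))
    (w : affineWeylGroup P) (i : Node b) : F (alcoveVertex b w i) = F' (alcoveVertex b w i) := by
  suffices ∀ w i, F (alcoveVertex b (u * w) i) = F' (alcoveVertex b (u * w) i) by
    simpa using this (u⁻¹ * w) i
  refine simpleReflection_induction (b := b) (by simpa using hu) fun w j ih => ?_
  rw [← mul_assoc]
  exact h.eq_on_mul_simpleReflection h' ih j

end IsChart

end Charts

/-! ### The Weyl distance of a building -/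

namespace Building

variable {ι M N : Type*} [AddCommGroup M] [Module ℝ M] [AddCommGroup N] [Module ℝ N]
  {P : RootPairing ι ℝ M N} [P.IsRootSystem] [Nonempty ι] {b : P.Base} {V : Type*}
  {X : Building b V} {A A' : PreAbstractSimplicialComplex V} {F F' : N → V} {c : Finset V}

variable (X) in
/-- The chambers of a building. -/
abbrev Chamber : Type _ := {c : Finset V // IsChamber X.complex c}

theorem exists_isChart (hA : A ∈ X.apartments) : ∃ F : N → V, IsChart b A F :=
  (X.apartment_iso A hA).imp fun _ h => h.isChart

theorem exists_cell_eq (hA : A ∈ X.apartments) (hF : IsChart b A F)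
    (hc : IsChamber X.complex c) (hcA : c ∈ A) : ∃ w, cell b F w = c := by
  obtain ⟨-, w, hw⟩ := (hF.mem_iff c).1 hcA
  exact ⟨w, (Maximal.eq_of_le hc (X.apartment_le A hA (hF.cell_mem w)) hw).symm⟩

theorem Marking.isChart_emb (m : X.Marking) : IsChart b m.apartment m.emb :=
  m.isSimplicialIso.isChart

/-- `F` is a chart of an apartment that agrees with the marking on the alcove `1`. -/
def Marking.IsBasedChart (m : X.Marking) (F : N → V) : Prop :=
  (∃ A ∈ X.apartments, IsChart b A F) ∧ ∀ i, F (alcoveVertex b 1 i) = m.emb (alcoveVertex b 1 i)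

theorem Marking.isBasedChart_emb (m : X.Marking) : m.IsBasedChart m.emb :=
  ⟨⟨_, m.mem_apartments, m.isChart_emb⟩, fun _ => rfl⟩

/-- `F` is a chart of the apartment `A` that preserves types. -/
structure Marking.IsTypedChart (m : X.Marking) (A : PreAbstractSimplicialComplex V)
    (F : N → V) : Prop where
  mem : A ∈ X.apartments
  isChart : IsChart b A F
  type : ∀ w i, m.typeFunction (F (alcoveVertex b w i)) = i

theorem Marking.IsTypedChart.comp_smul {m : X.Marking} (h : m.IsTypedChart A F)
    (u : affineWeylGroup P) : m.IsTypedChart A fun x => F (u • x) :=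
  ⟨h.mem, h.isChart.comp_smul u, fun w i => by rw [← alcoveVertex_mul, h.type]⟩

variable [Finite ι] [P.IsCrystallographic] [P.IsReduced] [P.IsIrreducible]

theorem card_eq_of_isChamber (hc : IsChamber X.complex c) : c.card = Fintype.card (Node b) := by
  obtain ⟨A, hA, hcA, -⟩ := X.exists_apartment c c hc hc
  obtain ⟨F, hF⟩ := exists_isChart hA
  obtain ⟨w, rfl⟩ := exists_cell_eq hA hF hc hcA
  exact hF.card_cell w

theorem isChamber_cell (hA : A ∈ X.apartments) (hF : IsChart b A F) (w : affineWeylGroup P) :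
    IsChamber X.complex (cell b F w) := by
  obtain ⟨c, hc, hsub⟩ := X.exists_chamber _ (X.apartment_le A hA (hF.cell_mem w))
  rwa [Finset.eq_of_subset_of_card_le hsub (by rw [card_eq_of_isChamber hc, hF.card_cell])]

theorem exists_isSimplicialIso_of_eq_on_alcove (hA : A ∈ X.apartments) (hA' : A' ∈ X.apartments)
    (hF : IsChart b A F) (hF' : IsChart b A' F') {y : affineWeylGroup P}
    (hy : ∀ i, F (alcoveVertex b y i) = F' (alcoveVertex b y i)) :
    ∃ g : V → V, IsSimplicialIso A' A g ∧ (∀ x ∈ vertices (A ⊓ A'), g x = x) ∧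
      ∀ w i, g (F' (alcoveVertex b w i)) = F (alcoveVertex b w i) := by
  have hcell : cell b F y = cell b F' y := cell_congr hy
  obtain ⟨g, hg, hfix⟩ := X.exists_iso A hA A' hA'
    ⟨cell b F y, hF.cell_mem y, hcell ▸ hF'.cell_mem y⟩
  refine ⟨g, hg, hfix, fun w i =>
    (hF.eq_of_eq_on_alcove (u := y) (hF'.comp hg) (fun j => ?_) w i).symm⟩
  rw [Function.comp_apply, ← hy]
  exact (hfix _ (mem_vertices_inf (hF.cell_mem y) (hF'.cell_mem y) (alcoveVertex_mem_cell F y j)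
    (hcell ▸ alcoveVertex_mem_cell F y j))).symm

theorem alcoveVertex_eq_of_eq_on_alcove (hA : A ∈ X.apartments) (hA' : A' ∈ X.apartments)
    (hF : IsChart b A F) (hF' : IsChart b A' F') {y : affineWeylGroup P}
    (hy : ∀ i, F (alcoveVertex b y i) = F' (alcoveVertex b y i)) {v w : affineWeylGroup P}
    {i j : Node b} (hvw : F (alcoveVertex b v i) = F' (alcoveVertex b w j)) :
    alcoveVertex b v i = alcoveVertex b w j := by
  obtain ⟨g, -, hfix, hg⟩ := exists_isSimplicialIso_of_eq_on_alcove hA hA' hF hF' hy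
  have := hg w j
  rw [← hvw, hfix _ (mem_vertices_inf (hF.cell_mem v) (hF'.cell_mem w)
    (alcoveVertex_mem_cell F v i) (hvw ▸ alcoveVertex_mem_cell F' w j))] at this
  exact hF.inj this

namespace Marking

variable (m : X.Marking)

theorem exists_isBasedChart (hc : IsChamber X.complex c) :
    ∃ F, m.IsBasedChart F ∧ ∃ w, cell b F w = c := by
  obtain ⟨A, hA, hbase, hcA⟩ :=
    X.exists_apartment _ _ (isChamber_cell m.mem_apartments m.isChart_emb 1) hc
  obtain ⟨g, hg, hfix⟩ := X.exists_iso A hA m.apartment m.mem_apartments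
    ⟨_, hbase, m.isChart_emb.cell_mem 1⟩
  have hF : IsChart b A (g ∘ m.emb) := m.isChart_emb.comp hg
  exact ⟨g ∘ m.emb, ⟨⟨A, hA, hF⟩, fun i => hfix _ (mem_vertices_inf hbase
    (m.isChart_emb.cell_mem 1) (alcoveVertex_mem_cell _ _ i) (alcoveVertex_mem_cell _ _ i))⟩,
    exists_cell_eq hA hF hc hcA⟩

variable {m} in
theorem IsBasedChart.type_eq (hF : m.IsBasedChart F) (hF' : m.IsBasedChart F')
    {v w : affineWeylGroup P} {i j : Node b}
    (hvw : F (alcoveVertex b v i) = F' (alcoveVertex b w j)) : i = j := by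
  obtain ⟨⟨A, hA, hFA⟩, hbase⟩ := hF
  obtain ⟨⟨A', hA', hFA'⟩, hbase'⟩ := hF'
  exact type_eq_of_alcoveVertex_eq (alcoveVertex_eq_of_eq_on_alcove hA hA' hFA hFA' (y := 1)
    (fun k => by rw [hbase, hbase']) hvw)

theorem exists_isTypeFunction : ∃ τ, m.IsTypeFunction τ := by
  let point (q : {F // m.IsBasedChart F} × affineWeylGroup P × Node b) : V :=
    q.1.1 (alcoveVertex b q.2.1 q.2.2)
  let τ : V → Node b := Function.extend point (fun q => q.2.2) fun _ => none
  have hfactors : Function.FactorsThrough (fun q => q.2.2) point := fun q r hqr =>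
    q.1.2.type_eq r.1.2 hqr
  have hτ : ∀ F, m.IsBasedChart F → ∀ w i, τ (F (alcoveVertex b w i)) = i := fun F hF w i =>
    hfactors.extend_apply _ (⟨F, hF⟩, w, i)
  refine ⟨τ, hτ m.emb m.isBasedChart_emb, fun c hc => ?_⟩
  obtain ⟨F, hF, w, rfl⟩ := m.exists_isBasedChart hc
  refine ⟨fun _ _ => Set.mem_univ _, fun x hx y hy hxy => ?_,
    fun i _ => ⟨_, alcoveVertex_mem_cell F w i, hτ F hF w i⟩⟩
  obtain ⟨i, rfl⟩ := mem_cell.1 hx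
  obtain ⟨j, rfl⟩ := mem_cell.1 hy
  rw [hτ F hF, hτ F hF] at hxy
  rw [hxy]

theorem isTypeFunction_typeFunction : m.IsTypeFunction m.typeFunction := by
  rw [typeFunction, dif_pos m.exists_isTypeFunction]
  exact m.exists_isTypeFunction.choose_spec

theorem typeFunction_emb (w : affineWeylGroup P) (i : Node b) :
    m.typeFunction (m.emb (alcoveVertex b w i)) = i := m.isTypeFunction_typeFunction.1 w i

variable {m}

theorem eq_of_typeFunction_eq (hc : IsChamber X.complex c) {x y : V} (hx : x ∈ c)
    (hy : y ∈ c) (hxy : m.typeFunction x = m.typeFunction y) : x = y :=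
  (m.isTypeFunction_typeFunction.2 c hc).injOn hx hy hxy

variable (m) in
theorem exists_mem_typeFunction_eq (hc : IsChamber X.complex c) (i : Node b) :
    ∃ x ∈ c, m.typeFunction x = i :=
  (m.isTypeFunction_typeFunction.2 c hc).surjOn (Set.mem_univ i)

variable (m) in
theorem typeFunction_mul_simpleReflection (hA : A ∈ X.apartments) (hF : IsChart b A F)
    {u : affineWeylGroup P} (hu : ∀ i, m.typeFunction (F (alcoveVertex b u i)) = i)
    (j i : Node b) : m.typeFunction (F (alcoveVertex b (u * simpleReflection b j) i)) = i := by
  by_cases hij : i = j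
  swap
  · rw [alcoveVertex_mul_simpleReflection u hij, hu]
  subst hij
  obtain ⟨x, hx, hxi⟩ :=
    m.exists_mem_typeFunction_eq (isChamber_cell hA hF (u * simpleReflection b i)) i
  obtain ⟨k, rfl⟩ := mem_cell.1 hx
  by_cases hk : k = i
  · rwa [hk] at hxi
  · rw [alcoveVertex_mul_simpleReflection u hk, hu] at hxi
    exact absurd hxi hk

theorem isTypedChart_of_alcove (hA : A ∈ X.apartments) (hF : IsChart b A F)
    {y : affineWeylGroup P} (hy : ∀ i, m.typeFunction (F (alcoveVertex b y i)) = i) :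
    m.IsTypedChart A F := by
  refine ⟨hA, hF, ?_⟩
  suffices ∀ w i, m.typeFunction (F (alcoveVertex b (y * w) i)) = i from fun w i => by
    simpa using this (y⁻¹ * w) i
  refine simpleReflection_induction (b := b) (by simpa using hy) fun w j ih i => ?_
  rw [← mul_assoc]
  exact m.typeFunction_mul_simpleReflection hA hF ih j i

variable (m) in
theorem isTypedChart_emb : m.IsTypedChart m.apartment m.emb :=
  ⟨m.mem_apartments, m.isChart_emb, m.typeFunction_emb⟩

namespace IsTypedChart

variable {v w y : affineWeylGroup P}

theorem isChamber (h : m.IsTypedChart A F) (w : affineWeylGroup P) :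
    IsChamber X.complex (cell b F w) := isChamber_cell h.mem h.isChart w

theorem apply_alcoveVertex_eq (h : m.IsTypedChart A F) (h' : m.IsTypedChart A' F')
    (hvw : cell b F v = cell b F' w) (i : Node b) :
    F (alcoveVertex b v i) = F' (alcoveVertex b w i) :=
  eq_of_typeFunction_eq (m := m) (h.isChamber v) (alcoveVertex_mem_cell F v i)
    (hvw ▸ alcoveVertex_mem_cell F' w i) (by rw [h.type, h'.type])

theorem eq_of_cell_eq (h : m.IsTypedChart A F) (h' : m.IsTypedChart A' F')
    (hy : cell b F y = cell b F' y) (hvw : cell b F v = cell b F' w) : v = w :=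
  eq_of_alcoveVertex_eq (b := b) fun i => alcoveVertex_eq_of_eq_on_alcove h.mem h'.mem h.isChart
    h'.isChart (h.apply_alcoveVertex_eq h' hy) (h.apply_alcoveVertex_eq h' hvw i)

end IsTypedChart

variable (m) in
theorem exists_isTypedChart (hA : A ∈ X.apartments) (hc : IsChamber X.complex c) (hcA : c ∈ A)
    (y : affineWeylGroup P) : ∃ F, m.IsTypedChart A F ∧ cell b F y = c := by
  obtain ⟨F₀, ⟨⟨A₀, hA₀, hF₀⟩, hbase⟩, w, rfl⟩ := m.exists_isBasedChart hc
  have htyped : m.IsTypedChart A₀ F₀ :=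
    isTypedChart_of_alcove hA₀ hF₀ (y := 1) fun i => by rw [hbase, typeFunction_emb]
  obtain ⟨g, hg, hfix⟩ := X.exists_iso A hA A₀ hA₀ ⟨_, hcA, hF₀.cell_mem w⟩
  have hgw : ∀ i, (g ∘ F₀) (alcoveVertex b w i) = F₀ (alcoveVertex b w i) := fun i =>
    hfix _ (mem_vertices_inf hcA (hF₀.cell_mem w) (alcoveVertex_mem_cell _ _ i)
      (alcoveVertex_mem_cell _ _ i))
  have hF : m.IsTypedChart A (g ∘ F₀) := isTypedChart_of_alcove hA (hF₀.comp hg) (y := w)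
    fun i => by rw [hgw, htyped.type]
  refine ⟨_, hF.comp_smul (w * y⁻¹), ?_⟩
  rw [cell_comp_smul, inv_mul_cancel_right]
  exact cell_congr hgw

variable (m) in
theorem exists_isTypedChart_pair (c d : X.Chamber) (y : affineWeylGroup P) :
    ∃ A F, m.IsTypedChart A F ∧ cell b F y = c.1 ∧ ∃ w, cell b F w = d.1 := by
  obtain ⟨A, hA, hcA, hdA⟩ := X.exists_apartment c.1 d.1 c.2 d.2
  obtain ⟨F, hF, hc⟩ := m.exists_isTypedChart hA c.2 hcA y
  exact ⟨A, F, hF, hc, exists_cell_eq hA hF.isChart d.2 hdA⟩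

variable (m) in
theorem exists_isTypedChart_dist (c d : X.Chamber) :
    ∃ w A F, m.IsTypedChart A F ∧ cell b F 1 = c.1 ∧ cell b F w = d.1 := by
  obtain ⟨A, F, hF, hc, w, hd⟩ := m.exists_isTypedChart_pair c d 1
  exact ⟨w, A, F, hF, hc, hd⟩

variable (m) in
/-- The Weyl distance `δ(c, d)`: the alcove of `d` in an apartment in which `c` is the
alcove `1`. -/
def dist (c d : X.Chamber) : affineWeylGroup P := (m.exists_isTypedChart_dist c d).choose

theorem dist_eq (hF : m.IsTypedChart A F) {c d : X.Chamber} {v w : affineWeylGroup P}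
    (hv : cell b F v = c.1) (hw : cell b F w = d.1) : m.dist c d = v⁻¹ * w := by
  obtain ⟨A', F', hF', hc, hd⟩ := (m.exists_isTypedChart_dist c d).choose_spec
  refine hF'.eq_of_cell_eq (y := 1) (hF.comp_smul v) ?_ ?_
  · rw [hc, cell_comp_smul, mul_one, hv]
  · rw [cell_comp_smul, mul_inv_cancel_left, hw]
    exact hd

theorem dist_eq_of_cell_one_eq (hF : m.IsTypedChart A F) {c d : X.Chamber} {w : affineWeylGroup P}
    (hc : cell b F 1 = c.1) (hd : cell b F w = d.1) : m.dist c d = w := by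
  rw [dist_eq hF hc hd, inv_one, one_mul]

/-- The cell of a type-preserving chart, as a chamber. -/
def IsTypedChart.chamber (hF : m.IsTypedChart A F) (w : affineWeylGroup P) : X.Chamber :=
  ⟨cell b F w, hF.isChamber w⟩

theorem IsTypedChart.isIsometry (hF : m.IsTypedChart A F) : IsIsometry m.dist hF.chamber :=
  fun _ _ => dist_eq hF rfl rfl

theorem forall_mem_of_adjacent {i : Node b} {c d : X.Chamber} (h : m.Adjacent i c.1 d.1) {x : V}
    (hx : x ∈ c.1) (hxi : m.typeFunction x ≠ i) : x ∈ d.1 := by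
  obtain ⟨-, -, p, -, hp, hpc, hpd⟩ := h
  obtain ⟨y, hy, hyx⟩ := (hp _).2 hxi
  rw [← eq_of_typeFunction_eq c.2 (hpc hy) hx hyx]
  exact hpd hy

theorem adjacent_of_forall_mem {i : Node b} {c d : X.Chamber}
    (h : ∀ x ∈ c.1, m.typeFunction x ≠ i → x ∈ d.1) : m.Adjacent i c.1 d.1 := by
  classical
  obtain ⟨z, hz, hzi⟩ := m.exists_mem_typeFunction_eq c.2 i
  have hmem : ∀ x, x ∈ c.1.erase z ↔ x ∈ c.1 ∧ m.typeFunction x ≠ i := fun x => by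
    rw [Finset.mem_erase, and_comm]
    refine and_congr_right fun hx => ?_
    rw [not_iff_not, ← hzi]
    exact ⟨congrArg _, eq_of_typeFunction_eq c.2 hx hz⟩
  have hcotype : m.HasCotype (c.1.erase z) i := by
    refine fun j => ⟨?_, fun hj => ?_⟩
    · rintro ⟨x, hx, rfl⟩
      exact ((hmem x).1 hx).2
    · obtain ⟨x, hx, rfl⟩ := m.exists_mem_typeFunction_eq c.2 j
      exact ⟨x, (hmem x).2 ⟨hx, hj⟩, rfl⟩
  have : Nonempty b.support := b.support_nonempty.to_subtype
  obtain ⟨j, hj⟩ := exists_ne i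
  obtain ⟨x, hx, -⟩ := (hcotype j).2 hj
  exact ⟨c.2, d.2, c.1.erase z, ⟨mem_of_subset c.2.prop (Finset.erase_subset _ _) ⟨x, hx⟩,
    c.1, c.2, Finset.erase_subset _ _, (Finset.card_erase_add_one hz).symm⟩, hcotype,
    Finset.erase_subset _ _, fun x hx => h x ((hmem x).1 hx).1 ((hmem x).1 hx).2⟩

theorem adjacent_iff_dist {i : Node b} {c d : X.Chamber} :
    m.Adjacent i c.1 d.1 ↔ m.dist c d = 1 ∨ m.dist c d = simpleReflection b i := by
  obtain ⟨A, F, hF, hc, w, hd⟩ := m.exists_isTypedChart_pair c d 1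
  rw [dist_eq_of_cell_one_eq hF hc hd]
  constructor
  · intro h
    have := eq_or_eq_mul_simpleReflection (b := b) (v := 1) (w := w) (i := i) fun j hj => by
      have hjd := forall_mem_of_adjacent h (hc ▸ alcoveVertex_mem_cell F 1 j) (by rwa [hF.type])
      rw [← hd] at hjd
      exact (hF.isChart.mem_cell_iff.1 hjd).symm
    rwa [one_mul] at this
  · refine fun h => adjacent_of_forall_mem fun x hx hxi => ?_
    rw [← hc] at hx
    obtain ⟨j, rfl⟩ := mem_cell.1 hx
    rw [hF.type] at hxi
    rw [← hd, hF.isChart.mem_cell_iff]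
    rcases h with rfl | rfl
    · rfl
    · rw [← one_mul (simpleReflection b i), alcoveVertex_mul_simpleReflection 1 hxi]

theorem dist_step {c d d' : X.Chamber} {i : Node b} (hd : m.dist d d' = simpleReflection b i) :
    m.dist c d' = m.dist c d * simpleReflection b i ∨ m.dist c d' = m.dist c d := by
  obtain ⟨A₁, F₁, hF₁, hd₁, w₁, hd'₁⟩ := m.exists_isTypedChart_pair d d' 1
  obtain ⟨A, F, hF, hc, w, hw⟩ := m.exists_isTypedChart_pair c d 1
  obtain ⟨A', F', hF', hc', w', hw'⟩ := m.exists_isTypedChart_pair c d' 1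
  rw [dist_eq_of_cell_one_eq hF₁ hd₁ hd'₁] at hd
  rw [dist_eq_of_cell_one_eq hF hc hw, dist_eq_of_cell_one_eq hF' hc' hw', or_comm]
  refine eq_or_eq_mul_simpleReflection fun j hj => ?_
  have hdj : F (alcoveVertex b w j) = F₁ (alcoveVertex b 1 j) :=
    hF.apply_alcoveVertex_eq hF₁ (hw.trans hd₁.symm) j
  have hd'j : F' (alcoveVertex b w' j) = F₁ (alcoveVertex b w₁ j) :=
    hF'.apply_alcoveVertex_eq hF₁ (hw'.trans hd'₁.symm) j
  rw [hd, ← one_mul (simpleReflection b i), alcoveVertex_mul_simpleReflection 1 hj] at hd'j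
  exact (alcoveVertex_eq_of_eq_on_alcove hF.mem hF'.mem hF.isChart hF'.isChart
    (hF.apply_alcoveVertex_eq hF' (hc.trans hc'.symm)) (hdj.trans hd'j.symm)).symm

variable (m) in
theorem isWeylDistance_dist : IsWeylDistance b m.dist where
  eq_one_iff c d := by
    obtain ⟨A, F, hF, hc, w, hd⟩ := m.exists_isTypedChart_pair c d 1
    rw [dist_eq_of_cell_one_eq hF hc hd]
    constructor
    · rintro rfl
      exact Subtype.ext (hc.symm.trans hd)
    · rintro rfl
      exact hF.isChart.cell_injective (hd.trans hc.symm)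
  inv c d := by
    obtain ⟨A, F, hF, hc, w, hd⟩ := m.exists_isTypedChart_pair c d 1
    rw [dist_eq hF hc hd, dist_eq hF hd hc, mul_inv_rev, inv_inv]
  step := dist_step
  exists_step c d i := by
    obtain ⟨A, F, hF, hc, w, hd⟩ := m.exists_isTypedChart_pair c d 1
    refine ⟨hF.chamber (w * simpleReflection b i), ?_, ?_⟩
    · rw [dist_eq hF hd rfl, inv_mul_cancel_left]
    · rw [dist_eq hF hc rfl, dist_eq hF hc hd, mul_assoc]

variable {φ : affineWeylGroup P → X.Chamber}

theorem exists_isTypedChart_cell_eq (hφ : IsIsometry m.dist φ) (v w : affineWeylGroup P) :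
    ∃ A F, m.IsTypedChart A F ∧ cell b F v = (φ v).1 ∧ cell b F w = (φ w).1 := by
  obtain ⟨A, F, hF, hv, u, hu⟩ := m.exists_isTypedChart_pair (φ v) (φ w) v
  have hdist := dist_eq hF hv hu
  rw [hφ] at hdist
  exact ⟨A, F, hF, hv, mul_left_cancel hdist ▸ hu⟩

theorem exists_forall_isTypedChart_eq (hφ : IsIsometry m.dist φ) :
    ∃ F : N → V, ∀ A G, m.IsTypedChart A G → ∀ w, cell b G w = (φ w).1 →
      ∀ i, F (alcoveVertex b w i) = G (alcoveVertex b w i) := by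
  choose x hx hxtype using fun w i => m.exists_mem_typeFunction_eq (φ w).2 i
  have hxG : ∀ {A G}, m.IsTypedChart A G → ∀ {w}, cell b G w = (φ w).1 → ∀ i,
      x w i = G (alcoveVertex b w i) := fun {A G} hG {w} hw i =>
    eq_of_typeFunction_eq (φ w).2 (hx w i) (hw ▸ alcoveVertex_mem_cell G w i)
      (by rw [hxtype, hG.type])
  have hfactors : Function.FactorsThrough (fun q : affineWeylGroup P × Node b => x q.1 q.2)
      fun q : affineWeylGroup P × Node b => alcoveVertex b q.1 q.2 := fun q r hqr => by
    obtain ⟨A, G, hG, hq, hr⟩ := exists_isTypedChart_cell_eq hφ q.1 r.1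
    simp only [hxG hG hq, hxG hG hr]
    exact congrArg G hqr
  exact ⟨Function.extend (fun q : affineWeylGroup P × Node b => alcoveVertex b q.1 q.2)
    (fun q => x q.1 q.2) fun _ => x 1 none, fun A G hG w hw i =>
    (hfactors.extend_apply _ (w, i)).trans (hxG hG hw i)⟩

/-- Completeness of the apartment system enters here. -/
theorem exists_isTypedChart_of_isIsometry (hX : X.IsComplete) (hφ : IsIsometry m.dist φ) :
    ∃ A F, m.IsTypedChart A F ∧ ∀ w, cell b F w = (φ w).1 := by
  obtain ⟨F, hF⟩ := exists_forall_isTypedChart_eq hφ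
  have hcell : ∀ w, cell b F w = (φ w).1 := fun w => by
    obtain ⟨A, G, hG, hw, -⟩ := exists_isTypedChart_cell_eq hφ w w
    exact (cell_congr (hF A G hG w hw)).trans hw
  let A : PreAbstractSimplicialComplex V :=
    { faces := {s | s.Nonempty ∧ ∃ w, s ⊆ cell b F w}
      isRelLowerSet_faces := fun _ h =>
        ⟨h.1, fun _ hts ht => ⟨ht, h.2.imp fun _ hw => Finset.Subset.trans hts hw⟩⟩ }
  have hA : IsChart b A F := by
    refine ⟨fun {v i w j} hvw => ?_, fun s => Iff.rfl⟩
    obtain ⟨B, G, hG, hv, hw⟩ := exists_isTypedChart_cell_eq hφ v w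
    rw [hF B G hG v hv, hF B G hG w hw] at hvw
    exact hG.isChart.inj hvw
  have hAX : A ∈ X.apartments := by
    refine hX A ?_ ⟨F, hA.isSimplicialIso⟩
    rintro s ⟨hs, w, hw⟩
    exact mem_of_subset (φ w).2.prop (hcell w ▸ hw) hs
  refine ⟨A, F, ⟨hAX, hA, fun w i => ?_⟩, hcell⟩
  obtain ⟨B, G, hG, hw, -⟩ := exists_isTypedChart_cell_eq hφ w w
  rw [hF B G hG w hw, hG.type]

end Marking

end Building

/-! ### Sectors in the direction of `w₀ C₀` -/

section WeylChambers

variable {ι M N : Type*} [AddCommGroup M] [Module ℝ M] [AddCommGroup N] [Module ℝ N]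
  {P : RootPairing ι ℝ M N}

theorem root'_reflectionPerm (γ α : ι) (x : N) :
    P.root' (P.reflectionPerm γ α) x = P.root' α (P.coreflection γ x) := by
  rw [RootPairing.coreflection_apply]
  simp only [RootPairing.root', RootPairing.root_reflectionPerm,
    RootPairing.reflection_apply_root, map_sub, map_smul, LinearMap.sub_apply,
    LinearMap.smul_apply, smul_eq_mul, RootPairing.root_coroot_eq_pairing]
  ring

theorem exists_root'_eq_root'_apply {u : N ≃ₗ[ℝ] N} (hu : u ∈ finiteWeylGroup P) (α : ι) :
    ∃ β, ∀ x, P.root' β x = P.root' α (u x) := by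
  induction hu using Subgroup.closure_induction'' generalizing α with
  | mem u hu =>
    obtain ⟨γ, rfl⟩ := hu
    exact ⟨_, root'_reflectionPerm γ α⟩
  | inv_mem u hu =>
    obtain ⟨γ, rfl⟩ := hu
    rw [RootPairing.coreflection_inv]
    exact ⟨_, root'_reflectionPerm γ α⟩
  | one => exact ⟨α, fun _ => rfl⟩
  | mul u v _ _ ihu ihv =>
    obtain ⟨β, hβ⟩ := ihu α
    obtain ⟨γ, hγ⟩ := ihv β
    exact ⟨γ, fun x => by rw [hγ, hβ]; rfl⟩

variable {b : P.Base}

theorem neg_mem_weylChamber_iff {x : N} : -x ∈ weylChamber b ↔ x ∈ oppositeWeylChamber b :=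
  forall_congr' fun i => by rw [map_neg, neg_pos]

theorem neg_mem_oppositeWeylChamber_iff {x : N} :
    -x ∈ oppositeWeylChamber b ↔ x ∈ weylChamber b := by
  rw [← neg_mem_weylChamber_iff, neg_neg]

variable (b) in
/-- The subsector of `w₀ C₀` at depth `n`. -/
def deepSector (n : ℕ) : Set N := {x | ∀ i : b.support, P.root' i x < -n}

theorem deepSector_antitone : Antitone (deepSector b) := fun n n' h x hx i => by
  have := hx i
  have : (n : ℝ) ≤ n' := by exact_mod_cast h
  linarith

theorem deepSector_subset (n : ℕ) : deepSector b n ⊆ oppositeWeylChamber b :=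
  fun x hx i => (hx i).trans_le (by simp)

variable (b) in
/-- The positive roots that are negative at `x`; their number measures how far `x` is from the
fundamental Weyl chamber. -/
def negativeAt (x : N) : Set ι := {α | b.IsPos α ∧ P.root' α x < 0}

theorem ncard_negativeAt_coreflection_lt [P.IsCrystallographic] [P.IsReduced] [Finite ι] {x : N}
    {i : b.support} (hi : P.root' i x < 0) :
    (negativeAt b (P.coreflection i x)).ncard < (negativeAt b x).ncard := by
  have hipos : b.IsPos i := RootPairing.Base.isPos_of_mem_support i.2
  have hsub : P.reflectionPerm i '' negativeAt b (P.coreflection i x) ⊆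
      negativeAt b x \ {(i : ι)} := by
    rintro _ ⟨α, ⟨hα, hneg⟩, rfl⟩
    rw [← root'_reflectionPerm] at hneg
    have hne : α ≠ i := by
      rintro rfl
      rw [root'_reflectionPerm_self] at hneg
      linarith
    refine ⟨⟨hα.reflectionPerm i.2 hne, hneg⟩, fun he => ?_⟩
    rw [← P.reflectionPerm_self i α, Set.mem_singleton_iff.1 he,
      isPos_reflectionPerm_self_iff] at hα
    exact hα hipos
  rw [← Set.ncard_image_of_injective _ (P.reflectionPerm i).injective]
  exact (Set.ncard_le_ncard hsub (Set.toFinite _)).trans_lt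
    (Set.ncard_sdiff_singleton_lt_of_mem ⟨hipos, hi⟩ (Set.toFinite _))

theorem exists_apply_mem_weylChamber [P.IsCrystallographic] [P.IsReduced] [Finite ι] {x : N}
    (hx : ∀ α, P.root' α x ≠ 0) :
    ∃ u ∈ finiteWeylGroup P, u x ∈ weylChamber b := by
  induction hn : (negativeAt b x).ncard using Nat.strong_induction_on generalizing x with
  | _ n ih =>
    by_cases hmem : x ∈ weylChamber b
    · exact ⟨1, one_mem _, hmem⟩
    · simp only [weylChamber, Set.mem_ofPred_eq, not_forall, not_lt] at hmem
      obtain ⟨i, hi⟩ := hmem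
      obtain ⟨u, hu, hux⟩ := ih _ (hn ▸ ncard_negativeAt_coreflection_lt (hi.lt_of_ne (hx i)))
        (fun α => by rw [← root'_reflectionPerm]; exact hx _) rfl
      exact ⟨u * P.coreflection i, mul_mem hu (Subgroup.subset_closure ⟨_, rfl⟩), hux⟩

variable [P.IsRootSystem]

theorem root'_pos_of_mem_weylChamber {x : N} (hx : x ∈ weylChamber b) {α : ι} (hα : b.IsPos α) :
    0 < P.root' α x := by
  obtain ⟨i, hi⟩ := exists_one_le_coeff hα
  rw [root'_eq_sum_coeff b]
  exact Finset.sum_pos' (fun j _ => mul_nonneg (coeff_nonneg hα j) (hx j).le)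
    ⟨i, Finset.mem_univ _, mul_pos (by linarith) (hx i)⟩

theorem root'_neg_iff_of_mem_weylChamber {x : N} (hx : x ∈ weylChamber b) {α : ι} :
    P.root' α x < 0 ↔ ¬ b.IsPos α := by
  refine ⟨fun h hα => (root'_pos_of_mem_weylChamber hx hα).not_gt h, fun hα => ?_⟩
  have := root'_pos_of_mem_weylChamber hx ((isPos_reflectionPerm_self_iff b α).2 hα)
  rwa [root'_reflectionPerm_self, neg_pos] at this

theorem root'_ne_zero_of_mem_weylChamber {x : N} (hx : x ∈ weylChamber b) (α : ι) :
    P.root' α x ≠ 0 := by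
  by_cases hα : b.IsPos α
  · exact (root'_pos_of_mem_weylChamber hx hα).ne'
  · exact ((root'_neg_iff_of_mem_weylChamber hx).2 hα).ne

theorem apply_mem_oppositeWeylChamber {u : N ≃ₗ[ℝ] N} (hu : u ∈ finiteWeylGroup P) {x y : N}
    (hx : x ∈ weylChamber b) (hux : u x ∈ oppositeWeylChamber b) (hy : y ∈ weylChamber b) :
    u y ∈ oppositeWeylChamber b := fun i => by
  obtain ⟨β, hβ⟩ := exists_root'_eq_root'_apply hu i
  have hneg := hux i
  rw [← hβ, root'_neg_iff_of_mem_weylChamber hx] at hneg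
  rwa [← hβ, root'_neg_iff_of_mem_weylChamber hy]

theorem apply_mem_oppositeWeylChamber_iff {u : N ≃ₗ[ℝ] N} (hu : u ∈ finiteWeylGroup P) {x y : N}
    (hx : x ∈ weylChamber b) (hux : u x ∈ oppositeWeylChamber b) :
    u y ∈ oppositeWeylChamber b ↔ y ∈ weylChamber b := by
  refine ⟨fun huy => ?_, apply_mem_oppositeWeylChamber hu hx hux⟩
  have hinv : ∀ z, u⁻¹ (-u z) = -z := fun z => by
    rw [map_neg, ← LinearEquiv.mul_apply, inv_mul_cancel]
    rfl
  have := apply_mem_oppositeWeylChamber (inv_mem hu) (neg_mem_weylChamber_iff.2 hux)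
    (by rwa [hinv, neg_mem_oppositeWeylChamber_iff]) (neg_mem_weylChamber_iff.2 huy)
  rwa [hinv, neg_mem_oppositeWeylChamber_iff] at this

variable (b) in
/-- The sum of the fundamental coweights. -/
def coweightSum : N := ∑ i, fundamentalCoweight b i

theorem coweightSum_mem : coweightSum b ∈ coweightLattice b :=
  sum_mem fun i _ => AddSubgroup.subset_closure ⟨i, rfl⟩

theorem root'_coweightSum (α : ι) : ∃ k : ℤ, P.root' α (coweightSum b) = k := by
  obtain ⟨f, hf, -, -⟩ := exists_int_coeff_eq b α
  exact ⟨∑ i, f i, by simp [coweightSum, root'_fundamentalCoweight_eq_coeff, hf]⟩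

theorem root'_coweightSum_simple (i : b.support) : P.root' i (coweightSum b) = 1 := by
  classical
  simp [coweightSum, root'_fundamentalCoweight, Finsupp.single_apply]

theorem mem_deepSector_iff {n : ℕ} {x : N} :
    x ∈ deepSector b n ↔ x + n • coweightSum b ∈ oppositeWeylChamber b := by
  refine forall_congr' fun i => ?_
  rw [map_add, map_nsmul, root'_coweightSum_simple, nsmul_eq_mul, mul_one]
  exact lt_neg_iff_add_neg

theorem root'_lt_of_mem_deepSector {n : ℕ} {x : N} (hx : x ∈ deepSector b n) {α : ι}
    (hα : b.IsPos α) : P.root' α x < -n := by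
  obtain ⟨i, hi⟩ := exists_one_le_coeff hα
  have hsum : 1 ≤ P.root' α (coweightSum b) := by
    simp only [coweightSum, map_sum, root'_fundamentalCoweight_eq_coeff]
    exact hi.trans (Finset.single_le_sum (fun j _ => coeff_nonneg hα j) (Finset.mem_univ i))
  have hpos := root'_pos_of_mem_weylChamber
    (neg_mem_weylChamber_iff.2 (mem_deepSector_iff.1 hx)) hα
  rw [map_neg, map_add, map_nsmul, nsmul_eq_mul] at hpos
  have : (n : ℝ) ≤ n * P.root' α (coweightSum b) := le_mul_of_one_le_right n.cast_nonneg hsum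
  linarith

theorem isRegularPoint_sub_smul_coweightSum {x : N} (hx : IsRegularPoint P x) (n : ℤ) :
    IsRegularPoint P (x - (n : ℝ) • coweightSum b) := by
  rintro ⟨α, k⟩
  obtain ⟨l, hl⟩ := root'_coweightSum (b := b) α
  convert hx (α, k - n * l) using 1
  rw [affineEval_sub_smul, hl]
  simp only [affineEval, Int.cast_sub, Int.cast_mul]
  ring

variable [P.IsCrystallographic] [P.IsReduced] [P.IsIrreducible] [Finite ι] [Nonempty ι]

theorem basePoint_mem_weylChamber : basePoint b ∈ weylChamber b := (basePoint_mem b).1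

variable (b) in
theorem exists_longest : ∃ u ∈ finiteWeylGroup P, ∀ x,
    u x ∈ oppositeWeylChamber b ↔ x ∈ weylChamber b := by
  obtain ⟨u, hu, hmem⟩ := exists_apply_mem_weylChamber (b := b) (x := -basePoint b) fun α => by
    rw [map_neg, neg_ne_zero]
    exact root'_ne_zero_of_mem_weylChamber basePoint_mem_weylChamber α
  rw [map_neg, neg_mem_weylChamber_iff] at hmem
  exact ⟨u, hu, fun x => apply_mem_oppositeWeylChamber_iff hu basePoint_mem_weylChamber hmem⟩

theorem isSector_deepSector (n : ℕ) : IsSector b (deepSector b n) := by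
  obtain ⟨u, hu, hux⟩ := exists_longest b
  refine ⟨-(n • coweightSum b), neg_mem (nsmul_mem coweightSum_mem n), u, hu, ?_⟩
  ext x
  rw [mem_deepSector_iff]
  constructor
  · intro hx
    refine ⟨u.symm (x + n • coweightSum b), ?_, by simp⟩
    rwa [← hux, LinearEquiv.apply_symm_apply]
  · rintro ⟨y, hy, rfl⟩
    simpa using (hux y).2 hy

theorem apply_basePoint_mem_oppositeWeylChamber {u : N ≃ₗ[ℝ] N} (hu : u ∈ finiteWeylGroup P)
    {μ : N} (hsub : ∀ x ∈ weylChamber b, u x + μ ∈ oppositeWeylChamber b) :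
    u (basePoint b) ∈ oppositeWeylChamber b := by
  intro j
  set r := P.root' j (u (basePoint b)) with hr
  obtain ⟨β, hβ⟩ := exists_root'_eq_root'_apply hu j
  have hne : r ≠ 0 := by
    rw [hr, ← hβ]
    exact root'_ne_zero_of_mem_weylChamber basePoint_mem_weylChamber β
  by_contra! hle
  have ht : 0 < (|P.root' j μ| + 1) / r := div_pos (by positivity) (hle.lt_of_ne hne.symm)
  have hmem := hsub (((|P.root' j μ| + 1) / r) • basePoint b)
    (fun i => by
      rw [map_smul, smul_eq_mul]
      exact mul_pos ht (basePoint_mem_weylChamber i)) j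
  rw [map_add, map_smul, map_smul, smul_eq_mul, ← hr, div_mul_cancel₀ _ hne] at hmem
  linarith [neg_abs_le (P.root' j μ)]

theorem exists_deepSector_subset {T : Set N} (hT : IsSector b T)
    (hsub : T ⊆ oppositeWeylChamber b) : ∃ n, deepSector b n ⊆ T := by
  obtain ⟨μ, -, u, hu, rfl⟩ := hT
  have hbase := apply_basePoint_mem_oppositeWeylChamber hu fun x hx => hsub ⟨x, hx, rfl⟩
  obtain ⟨n, hn⟩ : ∃ n : ℕ, ∀ i : b.support, -P.root' i μ ≤ n := by
    obtain ⟨n, hn⟩ := exists_nat_ge (∑ i : b.support, |P.root' i μ|)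
    exact ⟨n, fun i => (neg_le_abs _).trans <| (Finset.single_le_sum
      (f := fun i : b.support => |P.root' i μ|) (fun i _ => abs_nonneg _)
      (Finset.mem_univ i)).trans hn⟩
  refine ⟨n, fun x hx => ⟨u.symm (x - μ), ?_, by simp⟩⟩
  rw [← apply_mem_oppositeWeylChamber_iff hu basePoint_mem_weylChamber hbase,
    LinearEquiv.apply_symm_apply]
  intro i
  rw [map_sub]
  linarith [hx i, hn i]

end WeylChambers

/-! ### Alcoves near infinity and positive crossings -/

section SectorFilter

variable {ι M N : Type*} [AddCommGroup M] [Module ℝ M] [AddCommGroup N] [Module ℝ N]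
  {P : RootPairing ι ℝ M N} [P.IsRootSystem] [Nonempty ι] {b : P.Base}

variable (b) in
/-- The filter on alcoves generated by the sets of alcoves in a subsector of `w₀ C₀`. -/
def sectorFilter : Filter (affineWeylGroup P) :=
  ⨅ n : ℕ, Filter.principal {y | alcove b y ⊆ deepSector b n}

theorem eventually_sectorFilter_iff {p : affineWeylGroup P → Prop} :
    (∀ᶠ y in sectorFilter b, p y) ↔ ∃ n, ∀ y, alcove b y ⊆ deepSector b n → p y := by
  have hbasis : (sectorFilter b).HasBasis (fun _ : ℕ => True)
      fun n => {y | alcove b y ⊆ deepSector b n} :=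
    Filter.hasBasis_iInf_principal (directed_of_isDirected_le
      fun n n' h y (hy : alcove b y ⊆ deepSector b n') => hy.trans (deepSector_antitone h))
  simp [hbasis.eventually_iff]

theorem isPositiveCrossing_or [P.IsCrystallographic] (i : Node b) (x : affineWeylGroup P) :
    IsPositiveCrossing b x (x * simpleReflection b i) ∨
      IsPositiveCrossing b (x * simpleReflection b i) x := by
  obtain ⟨f, hf, -⟩ := exists_affineEval_smul x⁻¹ (wall b i)
  have hpos : ∀ a ∈ alcove b x, 0 < affineEval P f a := by
    rintro _ ⟨z, hz, rfl⟩
    have := hf (x • z)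
    rw [inv_smul_smul] at this
    exact this ▸ (mem_fundamentalAlcove_iff b z).1 hz i
  have hneg : ∀ a ∈ alcove b (x * simpleReflection b i), affineEval P f a < 0 := by
    rintro _ ⟨z, hz, rfl⟩
    have := hf (x • weylReflection P (wall b i) • z)
    rw [inv_smul_smul, affineEval_weylReflection_self] at this
    change affineEval P f ((x * simpleReflection b i) • z) < 0
    rw [mul_smul, simpleReflection_eq_weylReflection, this]
    exact neg_neg_iff_pos.2 ((mem_fundamentalAlcove_iff b z).1 hz i)
  by_cases hf₁ : b.IsPos f.1
  · exact Or.inr ⟨f.1, hf₁, f.2, fun a ha => (hneg a ha).le, fun a ha => (hpos a ha).le⟩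
  · refine Or.inl ⟨_, (isPos_reflectionPerm_self_iff b f.1).2 hf₁, -f.2, fun a ha => ?_,
      fun a ha => ?_⟩
    · exact (affineEval_oppositeRoot f a).trans_le (neg_nonpos.2 (hpos a ha).le)
    · exact (neg_nonneg.2 (hneg a ha).le).trans_eq (affineEval_oppositeRoot f a).symm

variable [Finite ι] [P.IsCrystallographic] [P.IsReduced] [P.IsIrreducible]

theorem affineEval_neg_iff_of_mem_alcove {f : ι × ℤ} {y : affineWeylGroup P} {a a' : N}
    (ha : a ∈ alcove b y) (ha' : a' ∈ alcove b y) :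
    affineEval P f a < 0 ↔ affineEval P f a' < 0 := by
  obtain ⟨z, hz, rfl⟩ := ha
  obtain ⟨z', hz', rfl⟩ := ha'
  obtain ⟨g, hg, -⟩ := exists_affineEval_smul y f
  exact (hg z ▸ hg z' ▸ affineEval_neg_iff hz hz' g :)

theorem smul_basePoint_mem_alcove (y : affineWeylGroup P) : y • basePoint b ∈ alcove b y :=
  ⟨_, basePoint_mem b, rfl⟩

theorem alcove_subset_deepSector {y : affineWeylGroup P} {n : ℕ} {a : N} (ha : a ∈ alcove b y)
    (hmem : a ∈ deepSector b n) : alcove b y ⊆ deepSector b n := fun a' ha' i => by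
  have hneg : ∀ {x}, P.root' i x < -n ↔ affineEval P ((i : ι), (n : ℤ)) x < 0 := fun {x} => by
    rw [affineEval, Int.cast_natCast, lt_neg_iff_add_neg]
  exact hneg.2 ((affineEval_neg_iff_of_mem_alcove ha ha').1 (hneg.1 (hmem i)))

theorem exists_alcove_subset_deepSector (n : ℕ) :
    ∃ y : affineWeylGroup P, alcove b y ⊆ deepSector b n := by
  set x : N := basePoint b - ((n + 1 : ℤ) : ℝ) • coweightSum b with hx
  have hreg : IsRegularPoint P x :=
    isRegularPoint_sub_smul_coweightSum (isRegularPoint_of_mem (basePoint_mem b)) _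
  obtain ⟨L, hL⟩ := exists_listProd_smul_mem (b := b) hreg
  refine ⟨(listProd b L)⁻¹, alcove_subset_deepSector
    ⟨_, hL, inv_smul_smul (listProd b L) x⟩ fun i => ?_⟩
  have hlt := (root'_mem_Ioo_of_mem (basePoint_mem b)
    (RootPairing.Base.isPos_of_mem_support i.2)).2
  rw [hx, map_sub, map_smul, root'_coweightSum_simple, smul_eq_mul, mul_one]
  push_cast
  linarith

instance : (sectorFilter b).NeBot := by
  refine ⟨fun h => ?_⟩
  rw [← Filter.eventually_false_iff_eq_bot] at h
  obtain ⟨n, hn⟩ := eventually_sectorFilter_iff.1 h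
  obtain ⟨y, hy⟩ := exists_alcove_subset_deepSector (b := b) n
  exact hn y hy

theorem eventually_alcove_subset {T : Set N} (hT : IsSector b T)
    (hsub : T ⊆ oppositeWeylChamber b) : ∀ᶠ y in sectorFilter b, alcove b y ⊆ T := by
  obtain ⟨n, hn⟩ := exists_deepSector_subset hT hsub
  exact eventually_sectorFilter_iff.2 ⟨n, fun y hy => hy.trans hn⟩

theorem exists_isSector_of_eventually {p : affineWeylGroup P → Prop}
    (h : ∀ᶠ y in sectorFilter b, p y) :
    ∃ T, IsSector b T ∧ T ⊆ oppositeWeylChamber b ∧ ∀ y, alcove b y ⊆ T → p y := by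
  obtain ⟨n, hn⟩ := eventually_sectorFilter_iff.1 h
  exact ⟨_, isSector_deepSector n, deepSector_subset n, hn⟩

theorem eventually_affineEval_neg {f : ι × ℤ} (hf : b.IsPos f.1) :
    ∀ᶠ y in sectorFilter b, affineEval P f (y • basePoint b) < 0 := by
  refine eventually_sectorFilter_iff.2 ⟨f.2.toNat, fun y hy => ?_⟩
  have hlt := root'_lt_of_mem_deepSector (hy (smul_basePoint_mem_alcove y)) hf
  have hle : (f.2 : ℝ) ≤ f.2.toNat := by exact_mod_cast Int.self_le_toNat f.2
  rw [affineEval]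
  linarith

theorem sameSide_iff {i : Node b} {x y : affineWeylGroup P} {f : ι × ℤ}
    (hf : ∀ z, affineEval P f (x • z) = affineEval P (wall b i) z) :
    SameSide i x y ↔ 0 < affineEval P f (y • basePoint b) := by
  rw [SameSide, length_lt_simpleReflection_mul_iff, ← hf, ← mul_smul, mul_inv_cancel_left]

theorem affineEval_oppositeRoot_smul {f : ι × ℤ} {i : Node b} {x : affineWeylGroup P}
    (hx : ∀ a ∈ alcove b x, affineEval P f a ≤ 0)
    (hxs : ∀ a ∈ alcove b (x * simpleReflection b i), 0 ≤ affineEval P f a) (z : N) :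
    affineEval P (oppositeRoot P f) (x • z) = affineEval P (wall b i) z := by
  obtain ⟨g, hg, -⟩ := exists_affineEval_smul x (oppositeRoot P f)
  have hneg := (hx _ (smul_basePoint_mem_alcove x)).lt_of_ne (isRegularPoint_smul_basePoint b x f)
  have hpos := (hxs _ (smul_basePoint_mem_alcove _)).lt_of_ne
    (isRegularPoint_smul_basePoint b (x * simpleReflection b i) f).symm
  rw [← hg, eq_wall_of_separates (f := g) (i := i)]
  · rwa [hg, affineEval_oppositeRoot, neg_pos]
  · rwa [hg, affineEval_oppositeRoot, ← mul_smul, neg_neg_iff_pos]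

namespace IsPositiveCrossing

variable {i : Node b} {x : affineWeylGroup P}

/-- The sector `w₀ C₀` lies eventually on the negative side of every hyperplane. -/
theorem eventually_sameSide (h : IsPositiveCrossing b x (x * simpleReflection b i)) :
    ∀ᶠ y in sectorFilter b, SameSide i x y := by
  obtain ⟨α, hα, k, hx, hxs⟩ := h
  filter_upwards [eventually_affineEval_neg (b := b) (f := (α, k)) hα] with y hy
  rwa [sameSide_iff (affineEval_oppositeRoot_smul (f := (α, k)) hx hxs), affineEval_oppositeRoot,
    neg_pos]

theorem eventually_not_sameSide (h : IsPositiveCrossing b (x * simpleReflection b i) x) :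
    ∀ᶠ y in sectorFilter b, ¬ SameSide i x y := by
  have := eventually_sameSide (i := i) (x := x * simpleReflection b i)
    (by rwa [simpleReflection_mul_cancel_right])
  exact this.mono fun y hy => sameSide_mul_simpleReflection_iff.1 hy

theorem asymm (h : IsPositiveCrossing b x (x * simpleReflection b i)) :
    ¬ IsPositiveCrossing b (x * simpleReflection b i) x := fun h' => by
  obtain ⟨y, hy, hy'⟩ := (h.eventually_sameSide.and h'.eventually_not_sameSide).exists
  exact hy' hy

end IsPositiveCrossing

theorem eventually_sameSide_or (x : affineWeylGroup P) (i : Node b) :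
    (∀ᶠ y in sectorFilter b, SameSide i x y) ∨ ∀ᶠ y in sectorFilter b, ¬ SameSide i x y :=
  (isPositiveCrossing_or i x).imp IsPositiveCrossing.eventually_sameSide
    IsPositiveCrossing.eventually_not_sameSide

end SectorFilter

/-! ### The retraction centred at a sector -/

namespace Building.Marking

variable {ι M N : Type*} [AddCommGroup M] [Module ℝ M] [AddCommGroup N] [Module ℝ N]
  {P : RootPairing ι ℝ M N} [P.IsRootSystem] [Nonempty ι] {b : P.Base} {V : Type*}
  {X : Building b V} {m : X.Marking} {A : PreAbstractSimplicialComplex V} {F : N → V}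
  {y : affineWeylGroup P}

theorem isChamber_of_mem_neighbors {i : Node b} {c d : Finset V} (h : d ∈ m.neighbors i c) :
    IsChamber X.complex d := h.1.2.1

variable [Finite ι] [P.IsCrystallographic] [P.IsReduced] [P.IsIrreducible]

variable (m) in
/-- The chambers of the fixed apartment. -/
def base (w : affineWeylGroup P) : X.Chamber := m.isTypedChart_emb.chamber w

theorem isIsometry_base : IsIsometry m.dist m.base := m.isTypedChart_emb.isIsometry

theorem IsTypedChart.comp_eq_emb (hF : m.IsTypedChart A F) {f : V → V}
    (hf : IsSimplicialIso A m.apartment f) (hfix : ∀ x ∈ vertices (A ⊓ m.apartment), f x = x)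
    (hy : cell b F y = m.chamberAt y) (w : affineWeylGroup P) (i : Node b) :
    f (F (alcoveVertex b w i)) = m.emb (alcoveVertex b w i) := by
  refine (hF.isChart.comp hf).eq_of_eq_on_alcove m.isChart_emb (u := y) (fun j => ?_) w i
  refine (hfix _ (mem_vertices_inf (hF.isChart.cell_mem y) ?_ (alcoveVertex_mem_cell F y j)
    (alcoveVertex_mem_cell F y j))).trans (hF.apply_alcoveVertex_eq m.isTypedChart_emb hy j)
  rw [hy]
  exact m.isChart_emb.cell_mem y

theorem IsTypedChart.cell_eq_chamberAt (hF : m.IsTypedChart A F) (hy : cell b F y = m.chamberAt y)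
    {v : affineWeylGroup P} (hv : m.chamberAt v ∈ A) : cell b F v = m.chamberAt v := by
  obtain ⟨u, hu⟩ := exists_cell_eq hF.mem hF.isChart (m.base v).2 hv
  obtain rfl : u = v := hF.eq_of_cell_eq m.isTypedChart_emb hy hu
  exact hu

theorem RetractsTo.retractsAlong {c : X.Chamber} {w : affineWeylGroup P}
    (h : m.RetractsTo c.1 w) : RetractsAlong m.dist (sectorFilter b) m.base c w := by
  classical
  obtain ⟨A, hA, hcA, ⟨T, hT, hTsub, hAT⟩, f, hf, hfix, hfc⟩ := h
  have hsector := eventually_alcove_subset hT hTsub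
  obtain ⟨y, hy⟩ := hsector.exists
  obtain ⟨F, hF, hFy⟩ := m.exists_isTypedChart hA (m.base y).2 (hAT y hy) y
  refine ⟨hF.chamber, hF.isIsometry, Subtype.ext ?_, hsector.mono fun z hz =>
    Subtype.ext (hF.cell_eq_chamberAt hFy (hAT z hz))⟩
  obtain ⟨v, hv⟩ := exists_cell_eq hA hF.isChart c.2 hcA
  have himage := image_cell_eq (hF.comp_eq_emb hf hfix hFy v)
  rw [hv] at himage
  obtain rfl : v = w := m.isChart_emb.cell_injective (himage.symm.trans hfc)
  exact hv

theorem RetractsAlong.retractsTo (hX : X.IsComplete) {c : X.Chamber} {w : affineWeylGroup P}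
    (h : RetractsAlong m.dist (sectorFilter b) m.base c w) : m.RetractsTo c.1 w := by
  classical
  obtain ⟨φ, hφ, rfl, hev⟩ := h
  obtain ⟨T, hT, hTsub, hφT⟩ := exists_isSector_of_eventually hev
  obtain ⟨y, hy⟩ := (eventually_alcove_subset hT hTsub).exists
  obtain ⟨A, F, hF, hFφ⟩ := exists_isTypedChart_of_isIsometry hX hφ
  have hcell : ∀ z, alcove b z ⊆ T → cell b F z = m.chamberAt z := fun z hz => by
    rw [hFφ, hφT z hz]
    rfl
  obtain ⟨g, hg, hfix, hgF⟩ := exists_isSimplicialIso_of_eq_on_alcove m.mem_apartments hF.mem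
    m.isChart_emb hF.isChart fun i =>
      (hF.apply_alcoveVertex_eq m.isTypedChart_emb (hcell y hy) i).symm
  refine ⟨A, hF.mem, hFφ w ▸ hF.isChart.cell_mem w,
    ⟨T, hT, hTsub, fun z hz => hcell z hz ▸ hF.isChart.cell_mem z⟩, g, hg, by rwa [inf_comm], ?_⟩
  rw [← hFφ]
  exact image_cell_eq (hgF w)

theorem retractsAlong_retraction (hX : X.IsComplete) (c : X.Chamber) :
    RetractsAlong m.dist (sectorFilter b) m.base c (m.retraction c.1) := by
  have hex : ∃ w, m.RetractsTo c.1 w :=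
    (exists_retractsAlong m.isWeylDistance_dist isIsometry_base eventually_sameSide_or c).imp
      fun _ hw => RetractsAlong.retractsTo hX hw
  rw [retraction, dif_pos hex]
  exact RetractsTo.retractsAlong hex.choose_spec

theorem retraction_eq (hX : X.IsComplete) {c : X.Chamber} {w : affineWeylGroup P}
    (h : RetractsAlong m.dist (sectorFilter b) m.base c w) : m.retraction c.1 = w :=
  (retractsAlong_retraction hX c).unique h

theorem retraction_chamberAt_one (hX : X.IsComplete) : m.retraction (m.chamberAt 1) = 1 :=
  retraction_eq hX (c := m.base 1) ⟨m.base, isIsometry_base, rfl, .of_forall fun _ => rfl⟩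

/-! ### Neighbours of a chamber -/

theorem mem_neighbors_iff {i : Node b} {c d : X.Chamber} :
    d.1 ∈ m.neighbors i c.1 ↔ m.dist c d = simpleReflection b i := by
  change m.Adjacent i c.1 d.1 ∧ c.1 ≠ d.1 ↔ _
  rw [adjacent_iff_dist, Ne, ← Subtype.ext_iff, ← m.isWeylDistance_dist.eq_one_iff]
  constructor
  · rintro ⟨h | h, hne⟩
    · exact absurd h hne
    · exact h
  · intro h
    exact ⟨Or.inr h, by rw [h]; exact simpleReflection_ne_one i⟩

theorem exists_panel (i : Node b) (c : X.Chamber) :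
    ∃ p, IsPanel X.complex p ∧ m.HasCotype p i ∧ p ⊆ c.1 := by
  obtain ⟨-, -, p, hp, hpi, hpc, -⟩ := (adjacent_iff_dist (m := m) (i := i) (c := c) (d := c)).2
    (Or.inl (m.isWeylDistance_dist.self c))
  exact ⟨p, hp, hpi, hpc⟩

theorem mem_neighbors_iff_of_panel {i : Node b} {c : X.Chamber} {p : Finset V}
    (hp : IsPanel X.complex p) (hpi : m.HasCotype p i) (hpc : p ⊆ c.1) (d : Finset V) :
    d ∈ m.neighbors i c.1 ↔ (IsChamber X.complex d ∧ p ⊆ d) ∧ d ≠ c.1 := by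
  constructor
  · rintro ⟨h, hne⟩
    exact ⟨⟨h.2.1, fun x hx => forall_mem_of_adjacent (d := ⟨d, h.2.1⟩) h (hpc hx)
      ((hpi _).1 ⟨x, hx, rfl⟩)⟩, hne.symm⟩
  · rintro ⟨⟨hd, hpd⟩, hne⟩
    exact ⟨⟨c.2, hd, p, hp, hpi, hpc, hpd⟩, hne.symm⟩

/-- The chambers `i`-adjacent to `c` and different from it, as chambers on its panel of
cotype `i`. -/
def neighborsEquiv {i : Node b} {c : X.Chamber} {p : Finset V} (hp : IsPanel X.complex p)
    (hpi : m.HasCotype p i) (hpc : p ⊆ c.1) : m.neighbors i c.1 ≃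
      {x : {d // IsChamber X.complex d ∧ p ⊆ d} // x ≠ ⟨c.1, c.2, hpc⟩} :=
  (Equiv.subtypeEquivRight (mem_neighbors_iff_of_panel hp hpi hpc)).trans
    ((Equiv.subtypeSubtypeEquivSubtypeInter _ _).symm.trans
      (Equiv.subtypeEquivRight fun _ => not_congr (Subtype.ext_iff (a2 := ⟨c.1, c.2, hpc⟩)).symm))

theorem nonempty_neighbors_equiv (hreg : m.IsRegular) (i : Node b) (c d : X.Chamber) :
    Nonempty (m.neighbors i c.1 ≃ m.neighbors i d.1) := by
  classical
  obtain ⟨p, hp, hpi, hpc⟩ := exists_panel (m := m) i c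
  obtain ⟨p', hp', hpi', hpd⟩ := exists_panel (m := m) i d
  obtain ⟨e⟩ := hreg i p p' hp hp' hpi hpi'
  let e' := e.trans (Equiv.swap (e ⟨c.1, c.2, hpc⟩) ⟨d.1, d.2, hpd⟩)
  have hcd : e' ⟨c.1, c.2, hpc⟩ = ⟨d.1, d.2, hpd⟩ := Equiv.swap_apply_left _ _
  refine ⟨(neighborsEquiv hp hpi hpc).trans
    ((e'.subtypeEquiv fun x => ?_).trans (neighborsEquiv hp' hpi' hpd).symm)⟩
  rw [← hcd, e'.injective.ne_iff]

end Building.Marking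

/-! ### Galleries and labelled walks -/

section LabelledSteps

variable {ι M N : Type*} [AddCommGroup M] [Module ℝ M] [AddCommGroup N] [Module ℝ N]
  {P : RootPairing ι ℝ M N} [P.IsRootSystem] [Nonempty ι] {b : P.Base} {q : Node b → Type*}
  [∀ i, Zero (q i)] {l : ℕ} {word : Fin l → Node b} {v : affineWeylGroup P}

theorem LabelledWalk.ext {x y : LabelledWalk b q word v} (halcove : ∀ k, x.alcove k = y.alcove k)
    (hlabel : ∀ k, x.label k = y.label k) : x = y := by
  cases x
  cases y
  obtain rfl := funext halcove
  obtain rfl := funext hlabel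
  rfl

theorem IsLabelledStep.unique [Finite ι] [P.IsCrystallographic] [P.IsReduced] [P.IsIrreducible]
    {i : Node b} {x y y' : affineWeylGroup P} {z : q i} (h : IsLabelledStep b q i x y z)
    (h' : IsLabelledStep b q i x y' z) : y = y' := by
  rcases h with ⟨rfl, h⟩ | ⟨rfl, h, hz⟩ | ⟨rfl, -, hz⟩ <;>
    rcases h' with ⟨rfl, h'⟩ | ⟨rfl, h', hz'⟩ | ⟨rfl, -, hz'⟩
  · rfl
  · exact absurd h' h.asymm
  · rfl
  · exact absurd h h'.asymm
  · rfl
  · exact absurd hz' hz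
  · rfl
  · exact absurd hz hz'
  · rfl

end LabelledSteps

namespace Building.Marking

variable {ι M N : Type*} [AddCommGroup M] [Module ℝ M] [AddCommGroup N] [Module ℝ N]
  {P : RootPairing ι ℝ M N} [P.IsRootSystem] [Nonempty ι] {b : P.Base} {V : Type*}
  {X : Building b V} {m : X.Marking} {q : Node b → Type*} [∀ i, Zero (q i)]

variable (m q) in
/-- A labelling of the neighbours of every chamber for which the retraction centred at the sector
`w₀ C₀` turns a pair of neighbours into a step of a labelled walk. -/
structure Labelling where
  /-- the label of an `i`-neighbour -/
  equiv (c : X.Chamber) (i : Node b) : m.neighbors i c.1 ≃ q i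
  isLabelledStep (c : X.Chamber) (i : Node b) (d : m.neighbors i c.1) :
    IsLabelledStep b q i (m.retraction c.1) (m.retraction d.1) (equiv c i d)

namespace Labelling

variable (L : m.Labelling q) {l : ℕ} {word : Fin l → Node b} {v : affineWeylGroup P}

theorem eq_of_equiv_eq {c c' : X.Chamber} {i : Node b} {d : m.neighbors i c.1}
    {d' : m.neighbors i c'.1} (hc : c = c') (h : L.equiv c i d = L.equiv c' i d') :
    d.1 = d'.1 := by
  subst hc
  rw [(L.equiv c i).injective h]

/-- The gallery that starts at the chamber `c` and has the given labels. -/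
def gallery (c : X.Chamber) (z : ∀ k, q (word k)) (k : Fin (l + 1)) : X.Chamber :=
  Fin.induction (motive := fun _ => X.Chamber) c
    (fun k d => ⟨_, isChamber_of_mem_neighbors ((L.equiv d (word k)).symm (z k)).2⟩) k

theorem gallery_succ (c : X.Chamber) (z : ∀ k, q (word k)) (k : Fin l) :
    (L.gallery c z k.succ).1 = (L.equiv (L.gallery c z k.castSucc) (word k)).symm (z k) := rfl

theorem gallery_succ_mem_neighbors (c : X.Chamber) (z : ∀ k, q (word k)) (k : Fin l) :
    (L.gallery c z k.succ).1 ∈ m.neighbors (word k) (L.gallery c z k.castSucc).1 :=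
  ((L.equiv (L.gallery c z k.castSucc) (word k)).symm (z k)).2

variable [Finite ι] [P.IsCrystallographic] [P.IsReduced] [P.IsIrreducible]

theorem retraction_gallery (hX : X.IsComplete) (x : LabelledWalk b q word v) (k : Fin (l + 1)) :
    m.retraction (L.gallery (m.base 1) x.label k).1 = x.alcove k := by
  induction k using Fin.induction with
  | zero => exact (retraction_chamberAt_one hX).trans x.start.symm
  | succ k ih =>
    have hstep := L.isLabelledStep _ (word k)
      ((L.equiv (L.gallery (m.base 1) x.label k.castSucc) (word k)).symm (x.label k))
    rw [Equiv.apply_symm_apply, ih, ← gallery_succ] at hstep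
    exact hstep.unique (x.step k)

/-- The labelled walk of a gallery: its alcoves are the retractions of the chambers. -/
def toWalk (hX : X.IsComplete) (g : m.galleries word v) : LabelledWalk b q word v where
  alcove k := m.retraction (g.1 k)
  label k := L.equiv ⟨g.1 k.castSucc, g.2.1.1 _⟩ (word k) ⟨g.1 k.succ, g.2.1.2 k⟩
  start := by rw [g.2.2.1, retraction_chamberAt_one hX]
  finish := g.2.2.2
  step k := L.isLabelledStep ⟨g.1 k.castSucc, g.2.1.1 _⟩ (word k) ⟨g.1 k.succ, g.2.1.2 k⟩

theorem toWalk_injective (hX : X.IsComplete) :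
    Function.Injective (L.toWalk hX : m.galleries word v → _) := by
  intro g g' h
  have hlabel : ∀ k, (L.toWalk hX g).label k = (L.toWalk hX g').label k := fun k => by rw [h]
  refine Subtype.ext (funext fun k => ?_)
  induction k using Fin.induction with
  | zero => rw [g.2.2.1, g'.2.2.1]
  | succ k ih => exact L.eq_of_equiv_eq (Subtype.ext ih) (hlabel k)

theorem toWalk_surjective (hX : X.IsComplete) :
    Function.Surjective (L.toWalk hX : m.galleries word v → _) := fun x => by
  let c := L.gallery (m.base 1) x.label
  have hgallery : m.IsGallery word fun k => (c k).1 :=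
    ⟨fun k => (c k).2, L.gallery_succ_mem_neighbors _ _⟩
  refine ⟨⟨fun k => (c k).1, hgallery, rfl, (L.retraction_gallery hX x _).trans x.finish⟩,
    LabelledWalk.ext (L.retraction_gallery hX x) fun k => ?_⟩
  exact (L.equiv (c k.castSucc) (word k)).apply_symm_apply (x.label k)

end Labelling

variable [Finite ι] [P.IsCrystallographic] [P.IsReduced] [P.IsIrreducible]

/-- Towards the negative side exactly one neighbour retracts across the wall; it gets the
label `0`. -/
theorem exists_equiv_isLabelledStep (hX : X.IsComplete) (i : Node b) (c : X.Chamber)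
    (e : m.neighbors i c.1 ≃ q i) : ∃ e' : m.neighbors i c.1 ≃ q i, ∀ d,
      IsLabelledStep b q i (m.retraction c.1) (m.retraction d.1) (e' d) := by
  classical
  have hc := retractsAlong_retraction (m := m) hX c
  have hdist : ∀ d : m.neighbors i c.1,
      m.dist c ⟨d.1, isChamber_of_mem_neighbors d.2⟩ = simpleReflection b i :=
    fun d => mem_neighbors_iff.1 d.2
  rcases isPositiveCrossing_or i (m.retraction c.1) with h | h
  · exact ⟨e, fun d => Or.inl ⟨retraction_eq hX (hc.mul_simpleReflection_of_sameSide
      m.isWeylDistance_dist h.eventually_sameSide (hdist d)), h⟩⟩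
  obtain ⟨c', hcc', hcross, hfold⟩ :=
    hc.exists_of_not_sameSide m.isWeylDistance_dist h.eventually_not_sameSide
  let d' : m.neighbors i c.1 := ⟨c'.1, mem_neighbors_iff.2 hcc'⟩
  let e' := e.trans (Equiv.swap (e d') 0)
  have he' : e' d' = 0 := Equiv.swap_apply_left _ _
  refine ⟨e', fun d => ?_⟩
  by_cases hd : d = d'
  · subst hd
    exact Or.inr (Or.inr ⟨retraction_eq hX hcross, h, he'⟩)
  · refine Or.inr (Or.inl ⟨retraction_eq hX (hfold _ (hdist d) fun hdc => hd ?_), h, ?_⟩)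
    · exact Subtype.ext (Subtype.ext_iff.1 hdc :)
    · exact he' ▸ e'.injective.ne hd

theorem nonempty_labelling (hX : X.IsComplete)
    (hq : ∀ c : X.Chamber, ∀ i, Nonempty (m.neighbors i c.1 ≃ q i)) :
    Nonempty (m.Labelling q) := by
  choose e he using fun (c : X.Chamber) (i : Node b) =>
    exists_equiv_isLabelledStep hX i c (hq c i).some
  exact ⟨⟨e, he⟩⟩

end Building.Marking

end AffineBuilding

end

theorem propositionA3_general {ι M N V : Type*} [Finite ι] [Nonempty ι]
    [AddCommGroup M] [Module ℝ M] [AddCommGroup N] [Module ℝ N]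
    (P : RootPairing ι ℝ M N) [P.IsRootSystem] [P.IsCrystallographic] [P.IsReduced]
    [P.IsIrreducible] (b : P.Base)
    (X : AffineBuilding.Building b V) (hX : X.IsComplete) (m : X.Marking) (hreg : m.IsRegular)
    (q : AffineBuilding.Node b → Type*) [∀ i, Zero (q i)]
    (c₀ : Finset V) (hc₀ : AffineBuilding.IsChamber X.complex c₀)
    (hq : ∀ i, Nonempty (m.neighbors i c₀ ≃ q i))
    {l : ℕ} (word : Fin l → AffineBuilding.Node b)
    (v : AffineBuilding.affineWeylGroup P) :
    ∃ e : m.galleries word v ≃ AffineBuilding.LabelledWalk b q word v,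
      ∀ (g : m.galleries word v) (k : Fin (l + 1)),
        (e g).alcove k = m.retraction (g.1 k) := by
  obtain ⟨L⟩ : Nonempty (m.Labelling q) :=
    AffineBuilding.Building.Marking.nonempty_labelling hX fun c i => by
      obtain ⟨e⟩ :=
        AffineBuilding.Building.Marking.nonempty_neighbors_equiv hreg i c ⟨c₀, hc₀⟩
      exact (hq i).map e.trans
  exact ⟨Equiv.ofBijective (L.toWalk hX) ⟨L.toWalk_injective hX, L.toWalk_surjective hX⟩,
    fun _ _ => rfl⟩

theorem propositionA3 {ι M N V : Type*} [Finite ι] [Nonempty ι]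
    [AddCommGroup M] [Module ℝ M] [AddCommGroup N] [Module ℝ N]
    (P : RootPairing ι ℝ M N) [P.IsRootSystem] [P.IsCrystallographic] [P.IsReduced]
    [P.IsIrreducible] (b : P.Base)
    (X : AffineBuilding.Building b V) (hX : X.IsComplete) (m : X.Marking) (hreg : m.IsRegular)
    (q : AffineBuilding.Node b → Type*) [∀ i, Zero (q i)]
    (c₀ : Finset V) (hc₀ : AffineBuilding.IsChamber X.complex c₀)
    (hq : ∀ i, Nonempty (m.neighbors i c₀ ≃ q i))
    {l : ℕ} (word : Fin l → AffineBuilding.Node b) (hword : AffineBuilding.IsReducedWord b word)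
    (v : AffineBuilding.affineWeylGroup P) :
    ∃ e : m.galleries word v ≃ AffineBuilding.LabelledWalk b q word v,
      ∀ (g : m.galleries word v) (k : Fin (l + 1)),
        (e g).alcove k = m.retraction (g.1 k) :=
  propositionA3_general P b X hX m hreg q c₀ hc₀ hq word v
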